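/- Let $d\ge 1$, let $\mathbb S^d$ be the unit sphere in $\mathbb R^{d+1}$, let $a\in\mathbb R^{d+1}$ with $R=|a|\ne 1$, and let $q\in\mathbb R$, $q\neq 0$. Consider the logarithmic external field $Q(x)=-q\log|x-a|$. For a Borel probability measure $\mu$ on $\mathbb S^d$ let $$I_Q[\mu]=\iint \log\frac1{|x-y|}\,d\mu(x)\,d\mu(y)+2\int Q\,d\mu .$$ There is exactly one minimizer $\mu_Q$ of $I_Q$ among the Borel probability measures on $\mathbb S^d$ (the extremal measure), and there is exactly one signed Borel measure $\eta_Q$ on $\mathbb S^d$ with $\eta_Q(\mathbb S^d)=1$ whose logarithmic potential $\int\log\frac1{|x-y|}\,d\eta_Q(y)$ is defined and finite at every $x\in\mathbb S^d$ and such that $\int\log\frac1{|x-y|}\,d\eta_Q(y)+Q(x)$ is constant on $\mathbb S^d$ (the signed equilibrium). Set $\alpha=[(1+q)/q]^{1/d}$ (used only when $(1+q)/q>0$). If $\operatorname{supp}\mu_Q=\mathbb S^d$, then $\mu_Q=\eta_Q$. Moreover: (i) If $q>0$, then $\operatorname{supp}\mu_Q=\mathbb S^d$ if and only if $\dfrac{1+q}{q}\ge\dfrac{(R+1)^d}{|R-1|^d}$;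 equivalently, $R\ge\dfrac{\alpha+1}{\alpha-1}$ when $R>1$, and $R\le\dfrac{\alpha-1}{\alpha+1}$ when $0\le R<1$. (ii) If $q<0$, then $\operatorname{supp}\mu_Q=\mathbb S^d$ if and only if $\dfrac{1+q}{q}\le\dfrac{|R-1|^d}{(R+1)^d}$. If $q<-1$, this is equivalent to $R\ge\dfrac{1+\alpha}{1-\alpha}$ when $R>1$, and to $R\le\dfrac{1-\alpha}{1+\alpha}$ when $0\le R<1$. If $-1\le q<0$, the inequality holds for every $R\neq1$, so that $\operatorname{supp}\mu_Q=\mathbb S^d$. -/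

import Mathlib

open MeasureTheory

noncomputable section

/-- The unit sphere `S^d` in `ℝ^(d+1)`, as a compact metric space with its Borel σ-algebra.
Unit positive Borel measures supported on `S^d` are the terms of
`ProbabilityMeasure (UnitSphere d)`. -/
abbrev UnitSphere (d : ℕ) : Type :=
  Metric.sphere (0 : EuclideanSpace ℝ (Fin (d + 1))) 1

/-- The integral of an extended-real-valued function, as the integral of its positive part
minus the integral of its negative part. -/
def extIntegral {X : Type*} [MeasurableSpace X] (μ : Measure X) (f : X → EReal) : EReal :=
  ((∫⁻ x, (f x).toENNReal ∂μ : ENNReal) : EReal) - ((∫⁻ x, (-f x).toENNReal ∂μ : ENNReal) : EReal)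

/-- The logarithmic kernel `log (1 / |x - y|)`, with the value `+∞` on the diagonal. -/
def logKernel {d : ℕ} (x y : UnitSphere d) : EReal :=
  -ENNReal.log (edist x y)

/-- The logarithmic potential `U(x) = ∫ log (1 / |x - y|) dμ(y)` of a positive measure. -/
def logPotential {d : ℕ} (μ : Measure (UnitSphere d)) (x : UnitSphere d) : EReal :=
  extIntegral μ (fun y => logKernel x y)

/-- The logarithmic energy `∬ log (1 / |x - y|) dμ(x) dμ(y)` of a positive measure. -/
def logEnergy {d : ℕ} (μ : Measure (UnitSphere d)) : EReal :=
  extIntegral (μ.prod μ) (fun p => logKernel p.1 p.2)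

/-- The logarithmic external field `Q(x) = -q log |x - a|` of a point charge `q` at `a`. -/
def logField {d : ℕ} (a : EuclideanSpace ℝ (Fin (d + 1))) (q : ℝ)
    (x : EuclideanSpace ℝ (Fin (d + 1))) : ℝ :=
  -q * Real.log ‖x - a‖

/-- The weighted logarithmic energy: the energy of `μ` plus `2 ∫ Q dμ`. -/
def weightedLogEnergy {d : ℕ} (a : EuclideanSpace ℝ (Fin (d + 1))) (q : ℝ)
    (μ : ProbabilityMeasure (UnitSphere d)) : EReal :=
  logEnergy (μ : Measure (UnitSphere d)) +
    ((2 * ∫ x, logField a q (x : EuclideanSpace ℝ (Fin (d + 1)))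
      ∂(μ : Measure (UnitSphere d)) : ℝ) : EReal)

/-- `μ` is an extremal measure on `S^d` for the field `Q`: its weighted energy equals the
infimum of the weighted energies of all unit positive Borel measures on `S^d`. -/
def IsLogExtremal {d : ℕ} (a : EuclideanSpace ℝ (Fin (d + 1))) (q : ℝ)
    (μ : ProbabilityMeasure (UnitSphere d)) : Prop :=
  weightedLogEnergy a q μ = ⨅ ν : ProbabilityMeasure (UnitSphere d), weightedLogEnergy a q ν

/-- `η` is a signed logarithmic equilibrium on `S^d` for the field `Q`: a signed measure of
total charge `1` whose logarithmic potential is defined and finite everywhere on `S^d`, and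
whose weighted potential is constant everywhere on `S^d`. The potential of `η` is that of the
positive part of its Jordan decomposition minus that of the negative part. -/
def IsSignedLogEquilibrium {d : ℕ} (a : EuclideanSpace ℝ (Fin (d + 1))) (q : ℝ)
    (η : SignedMeasure (UnitSphere d)) : Prop :=
  η Set.univ = 1 ∧
    ∃ G : ℝ, ∀ x : UnitSphere d,
      logPotential η.toJordanDecomposition.posPart x ≠ ⊤ ∧
      logPotential η.toJordanDecomposition.negPart x ≠ ⊤ ∧
      logPotential η.toJordanDecomposition.posPart x
          - logPotential η.toJordanDecomposition.negPart x
          + ((logField a q (x : EuclideanSpace ℝ (Fin (d + 1))) : ℝ) : EReal) = (G : EReal)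

end

/-! The signed equilibrium can be written down. Let `σ` be the uniform probability measure and
`P_b(x) = |1 - |b|²| / |x - b|²`. A Möbius map `T` of the sphere satisfies `|Tx - Ty|² = |x - y|²
P_b(x) P_b(y)` and carries `P_b^d σ` to `σ`. Taking logarithms and using that `σ` has constant
potential, the potential of `P_b^d σ` is `C - log |x - b|` on the sphere
(`toReal_pot_poissonMeasure`). Hence `(1 + q - q P_a^d) σ` has mass one and constant weighted
potential.

The kernel is replaced by `log (2 / |x - y|) = -½ log (1 - t)` with `t = (1 + ⟨x, y⟩) / 2` in `[0,
1]`, a power series in `t` with positive coefficients. Each power of `t` is a positive combination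
of products `m(x) m(y)` of monomials, so the energy of a difference of measures is a sum of squares
of differences of moments. This gives lower semicontinuity, existence of the minimizer, and its
uniqueness, since moments determine the measure.

Uniqueness of the signed equilibrium does not use energies. Integrating a constant weighted
potential against `P_b^d σ` prescribes `∫ log |x - b|` for all `|b| < 1` up to a constant, which `b
= 0` fixes; expanding in powers recovers all moments. Constancy `σ`-almost everywhere is enough
(`add_eq_add_of_ae_const`).

A minimizer with full support has weighted potential constant `σ`-almost everywhere, by the
variational inequality and lower semicontinuity, so it equals the signed equilibrium and the density
`1 + q - q P_a^d` is nonnegative. Conversely, if the density is nonnegative, the signed equilibrium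
is a probability measure with constant weighted potential, hence the minimizer, and its density
vanishes at one point at most. The stated inequalities express nonnegativity at the maximum `(R + 1)
/ |R - 1|` of `P_a` when `q > 0`, and at the minimum `|R - 1| / (R + 1)` when `q < 0`. -/

section LogEquilibrium

open Filter Topology
open scoped ENNReal Pointwise RealInnerProductSpace

/-! ### The kernel shifted by `log 2`, as a power series with positive coefficients -/

namespace UnitSphere

variable {d : ℕ}

/-- The squared cosine of half of the angle between two points of the sphere. -/
noncomputable def cosSq (x y : UnitSphere d) : ℝ :=
  (1 + ⟪(x : EuclideanSpace ℝ (Fin (d + 1))), y⟫) / 2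

theorem norm_coe (x : UnitSphere d) : ‖(x : EuclideanSpace ℝ (Fin (d + 1)))‖ = 1 :=
  mem_sphere_zero_iff_norm.1 x.2

theorem dist_sq (x y : UnitSphere d) : dist x y ^ 2 = 4 * (1 - cosSq x y) := by
  rw [Subtype.dist_eq, dist_eq_norm, norm_sub_sq_real, norm_coe, norm_coe, cosSq]
  ring

theorem cosSq_comm (x y : UnitSphere d) : cosSq x y = cosSq y x := by
  rw [cosSq, cosSq, real_inner_comm]

theorem cosSq_nonneg (x y : UnitSphere d) : 0 ≤ cosSq x y := by
  have h := neg_le_of_abs_le (abs_real_inner_le_norm (x : EuclideanSpace ℝ (Fin (d + 1))) y)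
  rw [norm_coe, norm_coe] at h
  unfold cosSq
  linarith

theorem dist_le_two (x y : UnitSphere d) : dist x y ≤ 2 := by
  nlinarith [dist_sq x y, cosSq_nonneg x y, dist_nonneg (x := x) (y := y)]

theorem continuous_cosSq : Continuous fun p : UnitSphere d × UnitSphere d => cosSq p.1 p.2 := by
  unfold cosSq
  fun_prop

/-- The nonnegative logarithmic kernel `log (2 / |x - y|)`, as a series of powers. -/
noncomputable def logKer (x y : UnitSphere d) : ℝ≥0∞ :=
  ∑' k : ℕ, ENNReal.ofReal (cosSq x y ^ (k + 1) / (2 * (k + 1)))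

theorem logKer_comm (x y : UnitSphere d) : logKer x y = logKer y x := by
  rw [logKer, logKer, cosSq_comm]

theorem measurable_logKer :
    Measurable fun p : UnitSphere d × UnitSphere d => logKer p.1 p.2 := by
  unfold logKer
  have := continuous_cosSq (d := d)
  refine Measurable.tsum fun k => ?_
  exact (ENNReal.continuous_ofReal.comp (by fun_prop)).measurable

theorem logKer_of_ne {x y : UnitSphere d} (h : x ≠ y) :
    logKer x y = ENNReal.ofReal (Real.log 2 - Real.log (dist x y)) := by
  have hd : 0 < dist x y := dist_pos.2 h
  have h0 := cosSq_nonneg x y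
  have h1 : cosSq x y < 1 := by nlinarith [dist_sq x y]
  have hs := (Real.hasSum_pow_div_log_of_abs_lt_one
    (by rwa [abs_of_nonneg h0] : |cosSq x y| < 1)).mul_left (1 / 2)
  have he : 1 / 2 * -Real.log (1 - cosSq x y) = Real.log 2 - Real.log (dist x y) := by
    have : 1 - cosSq x y = (dist x y / 2) ^ 2 := by
      have := dist_sq x y
      rw [div_pow]; linarith
    rw [this, Real.log_pow, Real.log_div hd.ne' two_ne_zero]
    push_cast; ring
  rw [he] at hs
  have hs' : HasSum (fun k : ℕ => cosSq x y ^ (k + 1) / (2 * (k + 1)))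
      (Real.log 2 - Real.log (dist x y)) := by
    have hk : ∀ k : ℕ, cosSq x y ^ (k + 1) / (2 * ((k : ℝ) + 1)) =
        1 / 2 * (cosSq x y ^ (k + 1) / (k + 1)) := fun k => by rw [div_mul_div_comm, one_mul]
    simpa only [hk] using hs
  rw [← hs'.tsum_eq, logKer, ENNReal.ofReal_tsum_of_nonneg (fun k => by positivity) hs'.summable]

/-- On the diagonal the series is half the harmonic series, so it agrees with the value `+∞` of the
logarithmic kernel. -/
theorem logKer_self (x : UnitSphere d) : logKer x x = ⊤ := by
  have hc : cosSq x x = 1 := by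
    have := dist_sq x x
    rw [dist_self] at this
    linarith
  by_contra h
  rw [logKer] at h
  have hs : Summable fun k : ℕ => (ENNReal.ofReal (cosSq x x ^ (k + 1) / (2 * (k + 1)))).toReal :=
    ENNReal.summable_toReal h
  have hs2 : Summable fun k : ℕ => (1 : ℝ) / ((k + 1 : ℕ) : ℝ) := by
    refine (hs.mul_left 2).congr fun k => ?_
    rw [ENNReal.toReal_ofReal (by rw [hc]; positivity), hc]
    push_cast
    field_simp
    simp
  exact Real.not_summable_one_div_natCast ((summable_nat_add_iff 1).1 hs2)

theorem log_two_sub_log_dist_nonneg {x y : UnitSphere d} (h : x ≠ y) :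
    0 ≤ Real.log 2 - Real.log (dist x y) :=
  sub_nonneg.2 (Real.log_le_log (dist_pos.2 h) (dist_le_two x y))

theorem logKernel_of_ne {x y : UnitSphere d} (h : x ≠ y) :
    logKernel x y = ((-Real.log (dist x y) : ℝ) : EReal) := by
  rw [logKernel, edist_dist, ENNReal.log_ofReal_of_pos (dist_pos.2 h)]
  rfl

theorem logKernel_self (x : UnitSphere d) : logKernel x x = ⊤ := by
  simp [logKernel]

theorem toENNReal_logKernel_add (x y : UnitSphere d) :
    (logKernel x y + (Real.log 2 : ℝ)).toENNReal = logKer x y := by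
  by_cases h : x = y
  · subst h
    rw [logKernel_self, logKer_self, EReal.top_add_coe, EReal.toENNReal_top]
  · rw [logKernel_of_ne h, logKer_of_ne h, ← EReal.coe_add,
      EReal.toENNReal_of_ne_top (EReal.coe_ne_top _),
      EReal.toReal_coe]
    congr 1
    ring

theorem neg_log_two_le_logKernel (x y : UnitSphere d) :
    ((-Real.log 2 : ℝ) : EReal) ≤ logKernel x y := by
  by_cases h : x = y
  · subst h
    rw [logKernel_self]; exact le_top
  · rw [logKernel_of_ne h, EReal.coe_le_coe_iff]
    linarith [log_two_sub_log_dist_nonneg h]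

theorem measurable_logKernel :
    Measurable fun p : UnitSphere d × UnitSphere d => logKernel p.1 p.2 := by
  unfold logKernel
  have : Measurable fun p : UnitSphere d × UnitSphere d => edist p.1 p.2 := measurable_edist
  fun_prop

end UnitSphere

/-! ### Reduction of extended-real integrals to integrals of nonnegative functions -/

theorem extIntegral_of_le {X : Type*} [MeasurableSpace X] (μ : Measure X) [IsFiniteMeasure μ]
    {f : X → EReal} (hf : Measurable f) {c : ℝ} (hc : 0 ≤ c) (h : ∀ x, ((-c : ℝ) : EReal) ≤ f x) :
    extIntegral μ f =
      ((∫⁻ x, (f x + (c : ℝ)).toENNReal ∂μ : ℝ≥0∞) : EReal) -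
        ((c * μ.real Set.univ : ℝ) : EReal) := by
  -- Since `f ≥ -c`, the shifted function is its own positive part. Only additions occur, so the
  -- identity makes sense in `ℝ≥0∞` where `f` is infinite.
  have hpt : ∀ x, (f x + (c : ℝ)).toENNReal + (-f x).toENNReal
      = (f x).toENNReal + ENNReal.ofReal c := by
    intro x
    have hx := h x
    induction hfx : f x with
    | bot => rw [hfx] at hx; simp at hx
    | top => simp
    | coe r =>
      rw [hfx, EReal.coe_le_coe_iff] at hx
      rw [← EReal.coe_add, ← EReal.coe_neg]
      simp only [EReal.toENNReal_of_ne_top (EReal.coe_ne_top _), EReal.toReal_coe]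
      rcases le_total 0 r with hr | hr
      · rw [ENNReal.ofReal_of_nonpos (by linarith : -r ≤ 0), add_zero, ENNReal.ofReal_add hr hc]
      · rw [ENNReal.ofReal_of_nonpos hr, zero_add, ← ENNReal.ofReal_add (by linarith) (by linarith)]
        congr 1; ring
  have hneg : ∀ x, (-f x).toENNReal ≤ ENNReal.ofReal c := by
    intro x
    have h1 : -f x ≤ (c : EReal) := by
      rw [EReal.neg_le]
      simpa using h x
    refine (EReal.toENNReal_le_toENNReal h1).trans ?_
    rw [EReal.toENNReal_of_ne_top (EReal.coe_ne_top _), EReal.toReal_coe]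
  have hint : ∫⁻ x, (f x + (c : ℝ)).toENNReal ∂μ + ∫⁻ x, (-f x).toENNReal ∂μ
      = ∫⁻ x, (f x).toENNReal ∂μ + ENNReal.ofReal (c * μ.real Set.univ) := by
    rw [← lintegral_add_right _ (by fun_prop), lintegral_congr hpt,
      lintegral_add_right _ (by fun_prop),
      lintegral_const, ENNReal.ofReal_mul hc, ofReal_measureReal]
  have hfin : ∫⁻ x, (-f x).toENNReal ∂μ ≠ ⊤ := by
    refine ((lintegral_mono hneg).trans_lt ?_).ne
    rw [lintegral_const]
    exact ENNReal.mul_lt_top ENNReal.ofReal_lt_top (measure_lt_top _ _)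
  have hcm : 0 ≤ c * μ.real Set.univ := mul_nonneg hc measureReal_nonneg
  unfold extIntegral
  generalize ∫⁻ x, (f x + (c : ℝ)).toENNReal ∂μ = a at *
  generalize ∫⁻ x, (f x).toENNReal ∂μ = b at *
  generalize ∫⁻ x, (-f x).toENNReal ∂μ = n at *
  generalize c * μ.real Set.univ = m at *
  lift n to NNReal using hfin
  induction b with
  | top =>
    have : a = ⊤ := by
      by_contra ha
      rw [top_add] at hint
      exact ENNReal.add_ne_top.2 ⟨ha, ENNReal.coe_ne_top⟩ hint
    subst this
    rw [EReal.coe_ennreal_top, EReal.coe_nnreal_eq_coe_real, EReal.top_sub_coe, EReal.top_sub_coe]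
  | coe b =>
    have ha : a ≠ ⊤ := by
      rintro rfl
      rw [top_add] at hint
      exact ENNReal.add_ne_top.2 ⟨ENNReal.coe_ne_top, ENNReal.ofReal_ne_top⟩ hint.symm
    lift a to NNReal using ha
    have := congrArg ENNReal.toReal hint
    rw [ENNReal.toReal_add (by simp) (by simp), ENNReal.toReal_add (by simp) (by simp),
      ENNReal.toReal_ofReal hcm] at this
    simp only [ENNReal.coe_toReal] at this
    simp only [EReal.coe_nnreal_eq_coe_real]
    rw [← EReal.coe_sub, ← EReal.coe_sub, EReal.coe_eq_coe_iff]
    linarith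

/-! ### Potentials and mutual energies for the nonnegative kernel -/

namespace UnitSphere

variable {d : ℕ}

/-- The potential of a positive measure for the kernel `log (2 / |x - y|)`. -/
noncomputable def pot (μ : Measure (UnitSphere d)) (x : UnitSphere d) : ℝ≥0∞ :=
  ∫⁻ y, logKer x y ∂μ

/-- The mutual energy of two positive measures for the kernel `log (2 / |x - y|)`. -/
noncomputable def mutEnergy (μ ν : Measure (UnitSphere d)) : ℝ≥0∞ :=
  ∫⁻ x, pot ν x ∂μ

theorem measurable_logKer_left (x : UnitSphere d) : Measurable fun y => logKer x y :=
  (measurable_logKer.comp (measurable_prodMk_left (x := x)) :)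

theorem measurable_pot (μ : Measure (UnitSphere d)) [SFinite μ] : Measurable (pot μ) :=
  Measurable.lintegral_prod_right' (ν := μ)
    (f := fun p : UnitSphere d × UnitSphere d => logKer p.1 p.2) measurable_logKer

theorem logPotential_eq (μ : Measure (UnitSphere d)) [IsFiniteMeasure μ] (x : UnitSphere d) :
    logPotential μ x = (pot μ x : EReal) - ((Real.log 2 * μ.real Set.univ : ℝ) : EReal) := by
  have hm : Measurable fun y => logKernel x y :=
    (measurable_logKernel.comp (measurable_prodMk_left (x := x)) :)
  rw [logPotential, extIntegral_of_le μ hm (Real.log_nonneg one_le_two)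
    (neg_log_two_le_logKernel x)]
  simp only [toENNReal_logKernel_add, pot]

theorem logEnergy_eq (μ : Measure (UnitSphere d)) [IsProbabilityMeasure μ] :
    logEnergy μ = (mutEnergy μ μ : EReal) - ((Real.log 2 : ℝ) : EReal) := by
  rw [logEnergy, extIntegral_of_le (μ.prod μ) measurable_logKernel
    (Real.log_nonneg one_le_two) (fun p => neg_log_two_le_logKernel p.1 p.2)]
  simp only [toENNReal_logKernel_add, mutEnergy, pot]
  rw [lintegral_prod _ measurable_logKer.aemeasurable]
  simp

theorem mutEnergy_comm (μ ν : Measure (UnitSphere d)) [SFinite μ] [SFinite ν] :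
    mutEnergy μ ν = mutEnergy ν μ := by
  unfold mutEnergy pot
  rw [lintegral_lintegral_swap measurable_logKer.aemeasurable]
  simp only [logKer_comm]

end UnitSphere

/-! ### Energies as sums of products of moments; positive definiteness -/

namespace UnitSphere

variable {d : ℕ}

/-- The monomials in the constant function `1` and the coordinates. -/
noncomputable def mon {n : ℕ} (f : Fin n → Option (Fin (d + 1))) (x : UnitSphere d) : ℝ :=
  ∏ i, (f i).elim 1 fun j => (x : EuclideanSpace ℝ (Fin (d + 1))) j

theorem continuous_mon {n : ℕ} (f : Fin n → Option (Fin (d + 1))) : Continuous (mon f) := by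
  unfold mon
  refine continuous_finsetProd _ fun i _ => ?_
  cases f i with
  | none => exact continuous_const
  | some j => simp only [Option.elim]; fun_prop

theorem _root_.Continuous.integrable_of_compactSpace {X E : Type*} [TopologicalSpace X]
    [CompactSpace X] [T2Space X] [MeasurableSpace X] [OpensMeasurableSpace X] [NormedAddCommGroup E]
    {f : X → E} (hf : Continuous f) (μ : Measure X) [IsFiniteMeasure μ] : Integrable f μ := by
  rw [← integrableOn_univ]
  exact hf.continuousOn.integrableOn_compact isCompact_univ

theorem integrable_mon {n : ℕ} (f : Fin n → Option (Fin (d + 1))) (μ : Measure (UnitSphere d))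
    [IsFiniteMeasure μ] : Integrable (mon f) μ :=
  (continuous_mon f).integrable_of_compactSpace μ

/-- `2 * cosSq x y` is the inner product of `(1, x)` and `(1, y)`; expanding its powers gives a
positive definite kernel with separated variables. The index `none` stands for the extra coordinate
`1`. -/
theorem cosSq_pow (n : ℕ) (x y : UnitSphere d) :
    cosSq x y ^ n = (1 / 2) ^ n * ∑ f : Fin n → Option (Fin (d + 1)), mon f x * mon f y := by
  have h : cosSq x y = 1 / 2 * ∑ j : Option (Fin (d + 1)),
      (j.elim 1 fun j => (x : EuclideanSpace ℝ (Fin (d + 1))) j) *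
        (j.elim 1 fun j => (y : EuclideanSpace ℝ (Fin (d + 1))) j) := by
    rw [cosSq, Fintype.sum_option, PiLp.inner_apply]
    simp [mul_comm, div_eq_inv_mul]
  rw [h, mul_pow, Fintype.sum_pow]
  simp only [mon, Finset.prod_mul_distrib]

theorem integral_cosSq_pow (n : ℕ) (x : UnitSphere d) (ν : Measure (UnitSphere d))
    [IsFiniteMeasure ν] : ∫ y, cosSq x y ^ n ∂ν =
      (1 / 2) ^ n * ∑ f : Fin n → Option (Fin (d + 1)), mon f x * ∫ y, mon f y ∂ν := by
  simp only [cosSq_pow]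
  rw [integral_const_mul, integral_finsetSum _ fun f _ => (integrable_mon f ν).const_mul _]
  simp only [integral_const_mul]

/-- The `k`-th term of the mutual energy. -/
noncomputable def energyTerm (k : ℕ) (μ ν : Measure (UnitSphere d)) : ℝ :=
  (1 / 2) ^ (k + 1) / (2 * (k + 1)) *
    ∑ f : Fin (k + 1) → Option (Fin (d + 1)), (∫ x, mon f x ∂μ) * ∫ y, mon f y ∂ν

theorem pot_eq_tsum (ν : Measure (UnitSphere d)) [IsFiniteMeasure ν] (x : UnitSphere d) :
    pot ν x = ∑' k : ℕ, ENNReal.ofReal ((1 / 2) ^ (k + 1) / (2 * (k + 1)) *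
      ∑ f : Fin (k + 1) → Option (Fin (d + 1)), mon f x * ∫ y, mon f y ∂ν) := by
  have hc : ∀ k : ℕ, Continuous fun y => cosSq x y ^ (k + 1) / (2 * (k + 1)) := fun k => by
    have : Continuous fun y => cosSq x y := continuous_cosSq.comp (Continuous.prodMk_right x)
    fun_prop
  unfold pot logKer
  rw [lintegral_tsum fun k => (hc k).measurable.ennreal_ofReal.aemeasurable]
  refine tsum_congr fun k => ?_
  rw [← ofReal_integral_eq_lintegral_ofReal ((hc k).integrable_of_compactSpace ν)
    (ae_of_all _ fun y => by have := cosSq_nonneg x y; positivity),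
    integral_div, integral_cosSq_pow]
  congr 1
  ring

theorem integral_cosSq_pow_nonneg (n : ℕ) (x : UnitSphere d) (ν : Measure (UnitSphere d)) :
    0 ≤ ∫ y, cosSq x y ^ n ∂ν :=
  integral_nonneg fun y => pow_nonneg (cosSq_nonneg x y) n

theorem potTerm_nonneg (k : ℕ) (x : UnitSphere d) (ν : Measure (UnitSphere d))
    [IsFiniteMeasure ν] : 0 ≤ (1 / 2 : ℝ) ^ (k + 1) / (2 * (k + 1)) *
      ∑ f : Fin (k + 1) → Option (Fin (d + 1)), mon f x * ∫ y, mon f y ∂ν := by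
  have h := integral_cosSq_pow_nonneg (k + 1) x ν
  rw [integral_cosSq_pow] at h
  rw [div_mul_eq_mul_div]
  positivity

theorem continuous_potTerm (k : ℕ) (ν : Measure (UnitSphere d)) :
    Continuous fun x => (1 / 2 : ℝ) ^ (k + 1) / (2 * (k + 1)) *
      ∑ f : Fin (k + 1) → Option (Fin (d + 1)), mon f x * ∫ y, mon f y ∂ν := by
  have := fun (f : Fin (k + 1) → Option (Fin (d + 1))) => continuous_mon f
  fun_prop

/-- The potential is a sum of nonnegative continuous functions. -/
theorem lowerSemicontinuous_pot (ν : Measure (UnitSphere d)) [IsFiniteMeasure ν] :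
    LowerSemicontinuous (pot ν) := by
  have h : pot ν = _ := funext fun x => pot_eq_tsum ν x
  rw [h]
  exact lowerSemicontinuous_tsum fun k =>
    (ENNReal.continuous_ofReal.comp (continuous_potTerm k ν)).lowerSemicontinuous

theorem integral_potTerm (k : ℕ) (μ ν : Measure (UnitSphere d)) [IsFiniteMeasure μ] :
    ∫ x, (1 / 2 : ℝ) ^ (k + 1) / (2 * (k + 1)) *
      ∑ f : Fin (k + 1) → Option (Fin (d + 1)), mon f x * ∫ y, mon f y ∂ν ∂μ =
    energyTerm k μ ν := by
  rw [integral_const_mul, integral_finsetSum _ fun f _ => (integrable_mon f μ).mul_const _]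
  simp only [integral_mul_const, energyTerm]

theorem energyTerm_nonneg (k : ℕ) (μ ν : Measure (UnitSphere d)) [IsFiniteMeasure μ]
    [IsFiniteMeasure ν] : 0 ≤ energyTerm k μ ν := by
  rw [← integral_potTerm]
  exact integral_nonneg fun x => potTerm_nonneg k x ν

theorem mutEnergy_eq_tsum (μ ν : Measure (UnitSphere d)) [IsFiniteMeasure μ]
    [IsFiniteMeasure ν] : mutEnergy μ ν = ∑' k : ℕ, ENNReal.ofReal (energyTerm k μ ν) := by
  unfold mutEnergy
  simp only [pot_eq_tsum]
  rw [lintegral_tsum fun k =>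
    (continuous_potTerm k ν).measurable.ennreal_ofReal.aemeasurable]
  refine tsum_congr fun k => ?_
  rw [← ofReal_integral_eq_lintegral_ofReal ((continuous_potTerm k ν).integrable_of_compactSpace μ)
    (ae_of_all _ fun x => potTerm_nonneg k x ν), integral_potTerm]

theorem energyTerm_add_sub (k : ℕ) (μ ν : Measure (UnitSphere d)) :
    energyTerm k μ μ + energyTerm k ν ν - 2 * energyTerm k μ ν =
      (1 / 2) ^ (k + 1) / (2 * (k + 1)) *
        ∑ f : Fin (k + 1) → Option (Fin (d + 1)), (∫ x, mon f x ∂μ - ∫ x, mon f x ∂ν) ^ 2 := by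
  simp only [energyTerm, Finset.mul_sum, ← Finset.sum_add_distrib, ← Finset.sum_sub_distrib]
  exact Finset.sum_congr rfl fun f _ => by ring

theorem two_mul_energyTerm_le (k : ℕ) (μ ν : Measure (UnitSphere d)) :
    2 * energyTerm k μ ν ≤ energyTerm k μ μ + energyTerm k ν ν := by
  rw [← sub_nonneg, energyTerm_add_sub]
  positivity

theorem two_mul_mutEnergy_le (μ ν : Measure (UnitSphere d)) [IsFiniteMeasure μ]
    [IsFiniteMeasure ν] : 2 * mutEnergy μ ν ≤ mutEnergy μ μ + mutEnergy ν ν := by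
  rw [mutEnergy_eq_tsum, mutEnergy_eq_tsum, mutEnergy_eq_tsum, ← ENNReal.tsum_mul_left,
    ← ENNReal.tsum_add]
  refine ENNReal.tsum_le_tsum fun k => ?_
  rw [← ENNReal.ofReal_add (energyTerm_nonneg k μ μ) (energyTerm_nonneg k ν ν),
    ← ENNReal.ofReal_ofNat, ← ENNReal.ofReal_mul (by norm_num)]
  exact ENNReal.ofReal_le_ofReal (two_mul_energyTerm_le k μ ν)

/-- Finite measures on the sphere are determined by the moments of all linear functionals. -/
theorem measure_ext_of_moments {μ ν : Measure (UnitSphere d)} [IsFiniteMeasure μ]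
    [IsFiniteMeasure ν]
    (h : ∀ (u : EuclideanSpace ℝ (Fin (d + 1))) (k : ℕ),
      ∫ x, ⟪(x : EuclideanSpace ℝ (Fin (d + 1))), u⟫ ^ k ∂μ =
      ∫ x, ⟪(x : EuclideanSpace ℝ (Fin (d + 1))), u⟫ ^ k ∂ν) : μ = ν := by
  have hemb : MeasurableEmbedding
      (Subtype.val : UnitSphere d → EuclideanSpace ℝ (Fin (d + 1))) :=
    MeasurableEmbedding.subtype_coe Metric.isClosed_sphere.measurableSet
  -- The exponential series converges uniformly on the compact sphere, so the characteristic
  -- function can be integrated term by term and depends only on the moments.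
  have key : ∀ (u : EuclideanSpace ℝ (Fin (d + 1))) (ρ : Measure (UnitSphere d))
      [IsFiniteMeasure ρ], HasSum (fun k : ℕ => (Complex.I ^ k / (k.factorial : ℂ)) *
        ((∫ x, ⟪(x : EuclideanSpace ℝ (Fin (d + 1))), u⟫ ^ k ∂ρ : ℝ) : ℂ))
      (charFun (ρ.map Subtype.val) u) := by
    intro u ρ _
    rw [charFun_apply, hemb.integral_map]
    let F : ℕ → UnitSphere d → ℂ := fun k x =>
      ((⟪(x : EuclideanSpace ℝ (Fin (d + 1))), u⟫ : ℂ) * Complex.I) ^ k / (k.factorial : ℂ)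
    have hF : ∀ k, Continuous (F k) := fun k => by
      simp only [F]
      fun_prop
    have hb : ∀ k, ∀ x, ‖F k x‖ ≤ ‖u‖ ^ k / k.factorial := by
      intro k x
      simp only [F, norm_div, norm_pow, norm_mul, Complex.norm_I, mul_one, Complex.norm_real,
        Complex.norm_natCast]
      gcongr
      have := norm_inner_le_norm (𝕜 := ℝ) (x : EuclideanSpace ℝ (Fin (d + 1))) u
      rwa [norm_coe, one_mul] at this
    have hs := hasSum_integral_of_summable_integral_norm (μ := ρ) (F := F)
      (fun k => (hF k).integrable_of_compactSpace ρ) (by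
        refine Summable.of_nonneg_of_le (fun k => integral_nonneg fun x => norm_nonneg _)
          (fun k => integral_mono ((hF k).norm.integrable_of_compactSpace ρ)
            (integrable_const _) (hb k)) ?_
        simp only [integral_const]
        exact (Real.summable_pow_div_factorial ‖u‖).const_smul _)
    have e1 : ∀ x : UnitSphere d, ∑' k, F k x =
        Complex.exp ((⟪(x : EuclideanSpace ℝ (Fin (d + 1))), u⟫ : ℂ) * Complex.I) := fun x => by
      rw [Complex.exp_eq_exp_ℂ, NormedSpace.exp_eq_tsum_div]
    rw [integral_congr_ae (ae_of_all _ e1)] at hs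
    have e2 : ∀ k : ℕ, (Complex.I ^ k / (k.factorial : ℂ)) *
        ((∫ x, ⟪(x : EuclideanSpace ℝ (Fin (d + 1))), u⟫ ^ k ∂ρ : ℝ) : ℂ) = ∫ x, F k x ∂ρ := by
      intro k
      rw [← integral_complex_ofReal, ← integral_const_mul]
      refine integral_congr_ae (ae_of_all _ fun x => ?_)
      simp only [F]
      push_cast
      ring
    simpa only [e2] using hs
  have : μ.map Subtype.val = ν.map Subtype.val := by
    refine Measure.ext_of_charFun (funext fun u => ?_)
    refine (key u μ).unique ?_
    simpa only [h] using key u ν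
  rw [← hemb.comap_map μ, ← hemb.comap_map ν, this]

theorem inner_pow_eq_sum_mon (x : UnitSphere d) (u : EuclideanSpace ℝ (Fin (d + 1))) (k : ℕ) :
    ⟪(x : EuclideanSpace ℝ (Fin (d + 1))), u⟫ ^ k =
      ∑ f : Fin k → Fin (d + 1), (∏ i, u (f i)) * mon (fun i => some (f i)) x := by
  rw [PiLp.inner_apply, Fintype.sum_pow]
  refine Finset.sum_congr rfl fun f _ => ?_
  rw [mon, ← Finset.prod_mul_distrib]
  simp

/-- The energy of a signed measure vanishes only if the measure is zero. -/
theorem eq_of_mutEnergy_add_le {μ ν : Measure (UnitSphere d)} [IsFiniteMeasure μ]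
    [IsFiniteMeasure ν] (hμ : mutEnergy μ μ ≠ ⊤) (hν : mutEnergy ν ν ≠ ⊤)
    (h : mutEnergy μ μ + mutEnergy ν ν ≤ 2 * mutEnergy μ ν) : μ = ν := by
  have hle : ∀ k, ENNReal.ofReal (2 * energyTerm k μ ν) ≤
      ENNReal.ofReal (energyTerm k μ μ + energyTerm k ν ν) := fun k =>
    ENNReal.ofReal_le_ofReal (two_mul_energyTerm_le k μ ν)
  have hL : ∑' k, ENNReal.ofReal (energyTerm k μ μ + energyTerm k ν ν) =
      mutEnergy μ μ + mutEnergy ν ν := by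
    rw [mutEnergy_eq_tsum, mutEnergy_eq_tsum, ← ENNReal.tsum_add]
    exact tsum_congr fun k =>
      ENNReal.ofReal_add (energyTerm_nonneg k μ μ) (energyTerm_nonneg k ν ν)
  have hR : ∑' k, ENNReal.ofReal (2 * energyTerm k μ ν) = 2 * mutEnergy μ ν := by
    rw [mutEnergy_eq_tsum, ← ENNReal.tsum_mul_left]
    exact tsum_congr fun k => by
      rw [ENNReal.ofReal_mul (by norm_num), ENNReal.ofReal_ofNat]
  have hfin : 2 * mutEnergy μ ν ≠ ⊤ :=
    ((two_mul_mutEnergy_le μ ν).trans_lt (ENNReal.add_lt_top.2 ⟨hμ.lt_top, hν.lt_top⟩)).ne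
  -- The reverse inequality holds term by term and the sums are finite, so a single strict term
  -- would contradict `h`.
  have heq : ∀ k, energyTerm k μ μ + energyTerm k ν ν = 2 * energyTerm k μ ν := by
    intro k
    refine le_antisymm ?_ (two_mul_energyTerm_le k μ ν)
    by_contra hk
    have hlt : ENNReal.ofReal (2 * energyTerm k μ ν) <
        ENNReal.ofReal (energyTerm k μ μ + energyTerm k ν ν) :=
      (ENNReal.ofReal_lt_ofReal_iff_of_nonneg
        (mul_nonneg (by norm_num) (energyTerm_nonneg k μ ν))).2 (not_le.1 hk)
    have := ENNReal.tsum_lt_tsum (by rw [hR]; exact hfin) hle hlt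
    rw [hL, hR] at this
    exact this.not_ge h
  have hmon : ∀ (n : ℕ) (f : Fin (n + 1) → Option (Fin (d + 1))),
      ∫ x, mon f x ∂μ = ∫ x, mon f x ∂ν := by
    intro n f
    have h1 := energyTerm_add_sub n μ ν
    rw [heq n, sub_self] at h1
    have h2 := (mul_eq_zero.1 h1.symm).resolve_left (by positivity)
    have h3 := (Finset.sum_eq_zero_iff_of_nonneg fun f _ => sq_nonneg _).1 h2 f (Finset.mem_univ _)
    exact sub_eq_zero.1 (pow_eq_zero_iff two_ne_zero |>.1 h3)
  refine measure_ext_of_moments fun u k => ?_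
  cases k with
  -- The series has no term of exponent zero; the total mass is read off from the constant monomial
  -- in the first term.
  | zero => simpa [mon] using hmon 0 fun _ => none
  | succ k =>
    simp only [inner_pow_eq_sum_mon]
    rw [integral_finsetSum _ fun f _ => (integrable_mon _ μ).const_mul _,
      integral_finsetSum _ fun f _ => (integrable_mon _ ν).const_mul _]
    simp only [integral_const_mul, hmon]

theorem continuous_integral_mon {n : ℕ} (f : Fin n → Option (Fin (d + 1))) :
    Continuous fun μ : ProbabilityMeasure (UnitSphere d) =>
      ∫ x, mon f x ∂(μ : Measure (UnitSphere d)) :=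
  ProbabilityMeasure.continuous_integral_boundedContinuousFunction
    (BoundedContinuousFunction.mkOfCompact ⟨mon f, continuous_mon f⟩)

/-- Each term of the series is a polynomial in moments, hence weakly continuous, and is nonnegative.
-/
theorem lowerSemicontinuous_mutEnergy : LowerSemicontinuous
    fun μ : ProbabilityMeasure (UnitSphere d) =>
      mutEnergy (μ : Measure (UnitSphere d)) (μ : Measure (UnitSphere d)) := by
  simp only [mutEnergy_eq_tsum]
  refine lowerSemicontinuous_tsum fun k =>
    (ENNReal.continuous_ofReal.comp ?_).lowerSemicontinuous
  have := fun (f : Fin (k + 1) → Option (Fin (d + 1))) => continuous_integral_mon f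
  unfold energyTerm
  fun_prop

theorem pot_add (μ ν : Measure (UnitSphere d)) (x : UnitSphere d) :
    pot (μ + ν) x = pot μ x + pot ν x :=
  lintegral_add_measure _ _ _

theorem pot_smul (c : ℝ≥0∞) (μ : Measure (UnitSphere d)) (x : UnitSphere d) :
    pot (c • μ) x = c * pot μ x := by
  rw [pot, lintegral_smul_measure, smul_eq_mul]; rfl

theorem mutEnergy_add_left (μ ν ρ : Measure (UnitSphere d)) :
    mutEnergy (μ + ν) ρ = mutEnergy μ ρ + mutEnergy ν ρ :=
  lintegral_add_measure _ _ _

theorem mutEnergy_smul_left (c : ℝ≥0∞) (μ ν : Measure (UnitSphere d)) :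
    mutEnergy (c • μ) ν = c * mutEnergy μ ν := by
  rw [mutEnergy, lintegral_smul_measure, smul_eq_mul]; rfl

theorem pot_mono {μ ν : Measure (UnitSphere d)} (h : μ ≤ ν) (x : UnitSphere d) :
    pot μ x ≤ pot ν x :=
  lintegral_mono' h le_rfl

theorem mutEnergy_mono {μ ν μ' ν' : Measure (UnitSphere d)} (h : μ ≤ ν) (h' : μ' ≤ ν') :
    mutEnergy μ μ' ≤ mutEnergy ν ν' :=
  lintegral_mono' h fun x => pot_mono h' x

end UnitSphere

/-! ### Lorentz boosts and the conformal change of variables on the sphere -/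

section Boost

variable {E : Type*} [NormedAddCommGroup E] [InnerProductSpace ℝ E]

/-- The spatial part of the Lorentz boost in the direction `e`, with hyperbolic cosine `c` and
hyperbolic sine `s`, of the light-like vector `(x, ‖x‖)`. -/
noncomputable def boost (e : E) (c s : ℝ) (x : E) : E :=
  x + ((c - 1) * ⟪e, x⟫ + s * ‖x‖) • e

variable {e : E} {c s : ℝ}

theorem inner_boost_left (he : ‖e‖ = 1) (x : E) :
    ⟪e, boost e c s x⟫ = c * ⟪e, x⟫ + s * ‖x‖ := by
  rw [boost, inner_add_right, inner_smul_right, real_inner_self_eq_norm_sq, he]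
  ring

theorem boost_factor_nonneg (he : ‖e‖ = 1) (hc : 0 < c) (hcs : c ^ 2 - s ^ 2 = 1) (x : E) :
    0 ≤ c * ‖x‖ + s * ⟪e, x⟫ := by
  have h1 := abs_real_inner_le_norm e x
  rw [he, one_mul] at h1
  have h2 : |s| ≤ c := abs_le_of_sq_le_sq (by linarith) hc.le
  have h3 : |s * ⟪e, x⟫| ≤ c * ‖x‖ := by
    rw [abs_mul]
    exact mul_le_mul h2 h1 (abs_nonneg _) hc.le
  linarith [neg_le_of_abs_le h3]

theorem boost_factor_pos (he : ‖e‖ = 1) (hc : 0 < c) (hcs : c ^ 2 - s ^ 2 = 1) {x : E}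
    (hx : ‖x‖ = 1) : 0 < c + s * ⟪e, x⟫ := by
  have h1 := abs_real_inner_le_norm e x
  rw [he, hx, one_mul] at h1
  have h2 : |s| < c := abs_lt_of_sq_lt_sq (by linarith) hc.le
  have h3 : |s * ⟪e, x⟫| < c := by
    rw [abs_mul]
    calc |s| * |⟪e, x⟫| ≤ |s| * 1 := by gcongr
      _ < c := by linarith
  linarith [neg_lt_of_abs_lt h3]

/-- This is invariance of the Lorentz form `⟪x, y⟫ - ‖x‖ * ‖y‖` on light-like vectors: the boosted
time coordinate is `c * ‖x‖ + s * ⟪e, x⟫`, which `norm_boost` identifies with the norm of the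
boosted spatial part. -/
theorem inner_boost_boost (he : ‖e‖ = 1) (hcs : c ^ 2 - s ^ 2 = 1) (x y : E) :
    ⟪boost e c s x, boost e c s y⟫ = ⟪x, y⟫ - ‖x‖ * ‖y‖ +
      (c * ‖x‖ + s * ⟪e, x⟫) * (c * ‖y‖ + s * ⟪e, y⟫) := by
  have : ⟪boost e c s x, boost e c s y⟫ = ⟪x, y⟫ + ((c - 1) * ⟪e, y⟫ + s * ‖y‖) * ⟪e, x⟫ +
      ((c - 1) * ⟪e, x⟫ + s * ‖x‖) * (c * ⟪e, y⟫ + s * ‖y‖) := by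
    conv_lhs => rw [boost, inner_add_left, inner_smul_left, inner_boost_left he]
    rw [boost, inner_add_right, inner_smul_right, real_inner_comm x e]
    simp
  rw [this]
  linear_combination (⟪e, x⟫ * ⟪e, y⟫ - ‖x‖ * ‖y‖) * hcs

theorem norm_boost (he : ‖e‖ = 1) (hc : 0 < c) (hcs : c ^ 2 - s ^ 2 = 1) (x : E) :
    ‖boost e c s x‖ = c * ‖x‖ + s * ⟪e, x⟫ := by
  have h := inner_boost_boost he hcs x x
  rw [real_inner_self_eq_norm_sq, real_inner_self_eq_norm_sq] at h
  refine (sq_eq_sq₀ (norm_nonneg _) (boost_factor_nonneg he hc hcs x)).1 ?_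
  linarith

theorem boost_neg_boost (he : ‖e‖ = 1) (hc : 0 < c) (hcs : c ^ 2 - s ^ 2 = 1) (x : E) :
    boost e c (-s) (boost e c s x) = x := by
  rw [boost, inner_boost_left he, norm_boost he hc hcs, boost, add_assoc, ← add_smul]
  convert add_zero x
  convert zero_smul ℝ e
  linear_combination ⟪e, x⟫ * hcs

theorem boost_smul {r : ℝ} (hr : 0 ≤ r) (x : E) : boost e c s (r • x) = r • boost e c s x := by
  rw [boost, boost, inner_smul_right, norm_smul, Real.norm_of_nonneg hr, smul_add, smul_smul]
  congr 2
  ring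

theorem continuous_boost : Continuous (boost e c s) := by
  unfold boost
  fun_prop

theorem hasFDerivAt_norm {x : E} (hx : x ≠ 0) :
    HasFDerivAt (fun x : E => ‖x‖) (‖x‖⁻¹ • innerSL ℝ x) x := by
  have h1 : HasFDerivAt (fun x : E => ‖x‖ ^ 2) (2 • innerSL ℝ x) x :=
    (hasStrictFDerivAt_norm_sq x).hasFDerivAt
  have h2 := h1.sqrt (pow_ne_zero 2 (norm_ne_zero_iff.2 hx))
  simp only [Real.sqrt_sq (norm_nonneg _)] at h2
  convert h2 using 1
  ext v
  simp
  field_simp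

/-- The derivative of the coefficient of `e` in `boost e c s`. -/
noncomputable def boostForm (e : E) (c s : ℝ) (x : E) : E →L[ℝ] ℝ :=
  (c - 1) • innerSL ℝ e + s • ‖x‖⁻¹ • innerSL ℝ x

theorem hasFDerivAt_boost {x : E} (hx : x ≠ 0) :
    HasFDerivAt (boost e c s)
      (ContinuousLinearMap.id ℝ E + (boostForm e c s x).smulRight e) x := by
  refine (hasFDerivAt_id x).add (HasFDerivAt.smul_const ?_ e)
  exact ((innerSL ℝ e).hasFDerivAt.const_mul (c - 1)).add ((hasFDerivAt_norm hx).const_mul s)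

/-- The derivative is the identity plus a rank-one map, so its determinant is one plus the value of
the form at `e`. It equals `‖boost x‖ / ‖x‖`: the measure `dx / ‖x‖` on the light cone is Lorentz
invariant. -/
theorem det_fderiv_boost [FiniteDimensional ℝ E] (he : ‖e‖ = 1) {x : E} (hx : x ≠ 0) :
    (ContinuousLinearMap.id ℝ E + (boostForm e c s x).smulRight e).det =
      ‖x‖⁻¹ * (c * ‖x‖ + s * ⟪e, x⟫) := by
  have h : ((ContinuousLinearMap.id ℝ E + (boostForm e c s x).smulRight e : E →L[ℝ] E) :
      E →ₗ[ℝ] E) = LinearMap.transvection (boostForm e c s x : E →ₗ[ℝ] ℝ) e := by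
    ext v
    simp [LinearMap.transvection.apply]
  rw [ContinuousLinearMap.det, h, LinearMap.transvection.det]
  have hx' := norm_ne_zero_iff.2 hx
  simp only [boostForm, ContinuousLinearMap.coe_coe, add_apply,
    smul_apply, innerSL_apply_apply, real_inner_self_eq_norm_sq, he,
    smul_eq_mul, real_inner_comm]
  field_simp
  ring

theorem boost_ne_zero (he : ‖e‖ = 1) (hc : 0 < c) (hcs : c ^ 2 - s ^ 2 = 1) {x : E} (hx : x ≠ 0) :
    boost e c s x ≠ 0 := by
  intro h
  apply hx
  rw [← boost_neg_boost he hc hcs x, h]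
  simp [boost]

theorem image_boost (he : ‖e‖ = 1) (hc : 0 < c) (hcs : c ^ 2 - s ^ 2 = 1) :
    boost e c s '' {0}ᶜ = {0}ᶜ := by
  ext y
  constructor
  · rintro ⟨x, hx, rfl⟩
    exact boost_ne_zero he hc hcs hx
  · intro hy
    have hcs' : c ^ 2 - (-s) ^ 2 = 1 := by rwa [neg_sq]
    refine ⟨boost e c (-s) y, boost_ne_zero he hc hcs' hy, ?_⟩
    simpa using boost_neg_boost he hc hcs' y

theorem lintegral_boost [FiniteDimensional ℝ E] [MeasurableSpace E] [BorelSpace E]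
    (μ : Measure E) [μ.IsAddHaarMeasure] (he : ‖e‖ = 1) (hc : 0 < c)
    (hcs : c ^ 2 - s ^ 2 = 1) (g : E → ℝ≥0∞) :
    ∫⁻ x in {0}ᶜ, g x ∂μ =
      ∫⁻ x in {0}ᶜ, ENNReal.ofReal (‖x‖⁻¹ * ‖boost e c s x‖) * g (boost e c s x) ∂μ := by
  conv_lhs => rw [← image_boost he hc hcs]
  rw [lintegral_image_eq_lintegral_abs_det_fderiv_mul μ (measurableSet_singleton 0).compl
    (fun x hx => (hasFDerivAt_boost hx).hasFDerivWithinAt)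
    (Function.LeftInverse.injective (boost_neg_boost he hc hcs)).injOn]
  refine setLIntegral_congr_fun (measurableSet_singleton 0).compl fun x hx => ?_
  rw [det_fderiv_boost he hx, norm_boost he hc hcs, abs_of_nonneg]
  exact mul_nonneg (inv_nonneg.2 (norm_nonneg x)) (boost_factor_nonneg he hc hcs x)

theorem lintegral_polar [FiniteDimensional ℝ E] [MeasurableSpace E] [BorelSpace E]
    (μ : Measure E) [μ.IsAddHaarMeasure] {g : E → ℝ≥0∞} (hg : Measurable g) :
    ∫⁻ x in {0}ᶜ, g x ∂μ = ∫⁻ ω, ∫⁻ r, g (r.1 • ω.1)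
      ∂Measure.volumeIoiPow (Module.finrank ℝ E - 1) ∂μ.toSphere := by
  rw [← lintegral_subtype_comap (measurableSet_singleton 0).compl]
  have h := (μ.measurePreserving_homeomorphUnitSphereProd.symm
    (homeomorphUnitSphereProd E).toMeasurableEquiv).lintegral_comp_emb
    (homeomorphUnitSphereProd E).toMeasurableEquiv.symm.measurableEmbedding
    (fun x : ({0}ᶜ : Set E) => g x)
  rw [← h]
  exact lintegral_prod _ (by fun_prop)

/-- The change of variables in the whole space descends to the sphere by testing it on functions
homogeneous of degree zero, cut off at the unit ball, and integrating out the radius. -/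
theorem lintegral_toSphere_boost [FiniteDimensional ℝ E] [MeasurableSpace E] [BorelSpace E]
    (μ : Measure E) [μ.IsAddHaarMeasure] {n : ℕ} (hn : Module.finrank ℝ E = n + 1)
    (he : ‖e‖ = 1) (hc : 0 < c) (hcs : c ^ 2 - s ^ 2 = 1) {g : E → ℝ≥0∞} (hg : Measurable g) :
    ∫⁻ ω, ENNReal.ofReal (‖boost e c s ω.1‖⁻¹ ^ n) *
        g (‖boost e c s ω.1‖⁻¹ • boost e c s ω.1) ∂μ.toSphere = ∫⁻ ω, g ω.1 ∂μ.toSphere := by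
  let G : E → ℝ≥0∞ := (Metric.ball (0 : E) 1).indicator fun x => g (‖x‖⁻¹ • x)
  have hG : Measurable G :=
    (hg.comp (by fun_prop : Measurable fun x : E => ‖x‖⁻¹ • x)).indicator measurableSet_ball
  have hG1 : ∀ {x : E}, ‖x‖ < 1 → G x = g (‖x‖⁻¹ • x) := fun hx =>
    Set.indicator_of_mem (mem_ball_zero_iff.2 hx) _
  have hG0 : ∀ {x : E}, ¬‖x‖ < 1 → G x = 0 := fun hx =>
    Set.indicator_of_notMem (mt mem_ball_zero_iff.1 hx) _
  have hbm : Measurable (boost e c s) := continuous_boost.measurable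
  have h1 := lintegral_polar μ hG
  have h2 := lintegral_polar μ (g := fun x => ENNReal.ofReal (‖x‖⁻¹ * ‖boost e c s x‖) *
    G (boost e c s x)) (by fun_prop)
  rw [← lintegral_boost μ he hc hcs G, h1, hn, Nat.add_sub_cancel] at h2
  have hvol : ENNReal.ofReal (1 / ((n : ℝ) + 1)) ≠ 0 :=
    (ENNReal.ofReal_pos.2 (by positivity)).ne'
  have e1 : ∀ ω : Metric.sphere (0 : E) 1, ∫⁻ r, G (r.1 • ω.1) ∂Measure.volumeIoiPow n =
      g ω.1 * ENNReal.ofReal (1 / ((n : ℝ) + 1)) := by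
    intro ω
    have hω : ‖ω.1‖ = 1 := mem_sphere_zero_iff_norm.1 ω.2
    obtain ⟨r₀, hr₀⟩ : ∃ r₀ : Set.Ioi (0 : ℝ), r₀.1 = 1 := ⟨⟨1, Set.mem_Ioi.2 one_pos⟩, rfl⟩
    have : ∀ r : Set.Ioi (0 : ℝ), G (r.1 • ω.1) = (Set.Iio r₀).indicator (fun _ => g ω.1) r := by
      intro r
      have hr : 0 < r.1 := r.2
      have hnr : ‖r.1 • ω.1‖ = r.1 := by rw [norm_smul, hω, mul_one, Real.norm_of_nonneg hr.le]
      by_cases hr1 : r.1 < r₀.1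
      · have hmem : r ∈ Set.Iio r₀ := hr1
        rw [Set.indicator_of_mem hmem, hG1 (by rwa [hnr, ← hr₀]), hnr, inv_smul_smul₀ hr.ne']
      · have hmem : r ∉ Set.Iio r₀ := hr1
        rw [Set.indicator_of_notMem hmem, hG0 (by rwa [hnr, ← hr₀])]
    rw [lintegral_congr this, lintegral_indicator_const measurableSet_Iio,
      Measure.volumeIoiPow_apply_Iio, hr₀, one_pow]
  -- With `m = ‖boost ω‖`, the cutoff becomes `r < 1 / m`. The Jacobian `m` times the radial
  -- integral `m⁻¹ ^ (n + 1) / (n + 1)` leaves the factor `m⁻¹ ^ n`.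
  have e2 : ∀ ω : Metric.sphere (0 : E) 1,
      ∫⁻ r, ENNReal.ofReal (‖r.1 • ω.1‖⁻¹ * ‖boost e c s (r.1 • ω.1)‖) *
        G (boost e c s (r.1 • ω.1)) ∂Measure.volumeIoiPow n =
      (ENNReal.ofReal (‖boost e c s ω.1‖⁻¹ ^ n) *
        g (‖boost e c s ω.1‖⁻¹ • boost e c s ω.1)) * ENNReal.ofReal (1 / ((n : ℝ) + 1)) := by
    intro ω
    have hω : ‖ω.1‖ = 1 := mem_sphere_zero_iff_norm.1 ω.2
    have hm : 0 < ‖boost e c s ω.1‖ := by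
      rw [norm_boost he hc hcs, hω, mul_one]
      exact boost_factor_pos he hc hcs hω
    set m := ‖boost e c s ω.1‖ with hmdef
    obtain ⟨r₀, hr₀⟩ : ∃ r₀ : Set.Ioi (0 : ℝ), r₀.1 = m⁻¹ := ⟨⟨m⁻¹, inv_pos.2 hm⟩, rfl⟩
    have : ∀ r : Set.Ioi (0 : ℝ), ENNReal.ofReal (‖r.1 • ω.1‖⁻¹ * ‖boost e c s (r.1 • ω.1)‖) *
        G (boost e c s (r.1 • ω.1)) =
        (Set.Iio r₀).indicator
          (fun _ => ENNReal.ofReal m * g (m⁻¹ • boost e c s ω.1)) r := by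
      intro r
      have hr : 0 < r.1 := r.2
      have hnr : ‖r.1 • ω.1‖ = r.1 := by rw [norm_smul, hω, mul_one, Real.norm_of_nonneg hr.le]
      have hbr : ‖boost e c s (r.1 • ω.1)‖ = r.1 * m := by
        rw [boost_smul hr.le, norm_smul, Real.norm_of_nonneg hr.le]
      have hiff : r.1 * m < 1 ↔ r.1 < r₀.1 := by
        rw [hr₀, ← one_div, lt_div_iff₀ hm]
      by_cases hr1 : r.1 < r₀.1
      · have hmem : r ∈ Set.Iio r₀ := hr1
        rw [Set.indicator_of_mem hmem, hG1 (by rw [hbr]; exact hiff.2 hr1), hnr, hbr,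
          inv_mul_cancel_left₀ hr.ne',
          boost_smul hr.le, smul_smul, mul_inv, mul_comm r.1⁻¹, mul_assoc, inv_mul_cancel₀ hr.ne',
          mul_one]
      · have hmem : r ∉ Set.Iio r₀ := hr1
        rw [Set.indicator_of_notMem hmem, hG0 (by rw [hbr]; exact mt hiff.1 hr1), mul_zero]
    rw [lintegral_congr this, lintegral_indicator_const measurableSet_Iio,
      Measure.volumeIoiPow_apply_Iio, hr₀, mul_right_comm, ← ENNReal.ofReal_mul hm.le,
      mul_right_comm, ← ENNReal.ofReal_mul (by positivity)]
    congr 2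
    rw [pow_succ]
    field_simp
  simp only [e1, e2] at h2
  rw [lintegral_mul_const' _ _ ENNReal.ofReal_ne_top,
    lintegral_mul_const' _ _ ENNReal.ofReal_ne_top] at h2
  exact ((ENNReal.mul_left_inj hvol ENNReal.ofReal_ne_top).1 h2).symm

end Boost

/-! ### Uniform measure, Poisson measures and their potentials -/

namespace UnitSphere

variable {d : ℕ}

/-- The uniform probability measure on the sphere. -/
noncomputable def unif (d : ℕ) : Measure (UnitSphere d) :=
  ((volume : Measure (EuclideanSpace ℝ (Fin (d + 1)))).toSphere Set.univ)⁻¹ •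
    (volume : Measure (EuclideanSpace ℝ (Fin (d + 1)))).toSphere

theorem toSphere_univ_ne_zero :
    (volume : Measure (EuclideanSpace ℝ (Fin (d + 1)))).toSphere Set.univ ≠ 0 := by
  rw [ne_eq, Measure.measure_univ_eq_zero]
  exact Measure.toSphere_ne_zero _

instance : IsProbabilityMeasure (unif d) where
  measure_univ := by
    rw [unif, Measure.smul_apply, smul_eq_mul,
      ENNReal.inv_mul_cancel toSphere_univ_ne_zero (measure_ne_top _ _)]

instance : (unif d).IsOpenPosMeasure where
  open_pos U hU hne := by
    rw [unif, Measure.smul_apply, smul_eq_mul]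
    exact mul_ne_zero (ENNReal.inv_ne_zero.2 (measure_ne_top _ _)) (hU.measure_ne_zero _ hne)

/-- The conformal factor on the sphere of a Möbius transformation that sends `b` to the centre. -/
noncomputable def poissonFactor (b : EuclideanSpace ℝ (Fin (d + 1))) (x : UnitSphere d) : ℝ :=
  |1 - ‖b‖ ^ 2| / ‖(x : EuclideanSpace ℝ (Fin (d + 1))) - b‖ ^ 2

/-- The balayage of the unit point mass at `b` onto the sphere, up to a constant potential. -/
noncomputable def poissonMeasure (b : EuclideanSpace ℝ (Fin (d + 1))) : Measure (UnitSphere d) :=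
  (unif d).withDensity fun x => ENNReal.ofReal (poissonFactor b x ^ d)

variable {b : EuclideanSpace ℝ (Fin (d + 1))}

theorem norm_coe_sub_pos (hb : ‖b‖ ≠ 1) (x : UnitSphere d) :
    0 < ‖(x : EuclideanSpace ℝ (Fin (d + 1))) - b‖ := by
  rw [norm_pos_iff, sub_ne_zero]
  rintro rfl
  exact hb (norm_coe x)

theorem abs_one_sub_sq_pos (hb : ‖b‖ ≠ 1) : 0 < |1 - ‖b‖ ^ 2| := by
  rw [abs_pos]
  intro h
  exact hb ((pow_eq_one_iff_of_nonneg (norm_nonneg b) two_ne_zero).1 (by linarith))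

theorem poissonFactor_pos (hb : ‖b‖ ≠ 1) (x : UnitSphere d) : 0 < poissonFactor b x :=
  div_pos (abs_one_sub_sq_pos hb) (pow_pos (norm_coe_sub_pos hb x) 2)

theorem continuous_poissonFactor (hb : ‖b‖ ≠ 1) :
    Continuous (poissonFactor b : UnitSphere d → ℝ) := by
  unfold poissonFactor
  exact continuous_const.div (by fun_prop) fun x => (pow_pos (norm_coe_sub_pos hb x) 2).ne'

theorem poissonFactor_zero (x : UnitSphere d) : poissonFactor 0 x = 1 := by
  simp [poissonFactor]

theorem poissonMeasure_zero : poissonMeasure (0 : EuclideanSpace ℝ (Fin (d + 1))) = unif d := by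
  simp [poissonMeasure, poissonFactor_zero]

theorem exists_boost_factor (hb : ‖b‖ ≠ 1) :
    ∃ (e : EuclideanSpace ℝ (Fin (d + 1))) (c s : ℝ), ‖e‖ = 1 ∧ 0 < c ∧ c ^ 2 - s ^ 2 = 1 ∧
      ∀ x : UnitSphere d, c + s * ⟪e, (x : EuclideanSpace ℝ (Fin (d + 1)))⟫ =
        (poissonFactor b x)⁻¹ := by
  obtain ⟨e, he, hbe⟩ : ∃ e : EuclideanSpace ℝ (Fin (d + 1)), ‖e‖ = 1 ∧ b = ‖b‖ • e := by
    by_cases h : b = 0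
    · exact ⟨EuclideanSpace.single 0 1, by simp, by simp [h]⟩
    · exact ⟨‖b‖⁻¹ • b, by simp [norm_smul, h], by simp [h]⟩
  have hpos := abs_one_sub_sq_pos hb
  have hsq := sq_abs (1 - ‖b‖ ^ 2)
  -- These come from dividing `‖x - b‖² = 1 + ‖b‖² - 2 ‖b‖ ⟪e, x⟫` by `|1 - ‖b‖²|`. The absolute
  -- value covers points inside and outside the sphere alike.
  refine ⟨e, (1 + ‖b‖ ^ 2) / |1 - ‖b‖ ^ 2|, -(2 * ‖b‖) / |1 - ‖b‖ ^ 2|, he, by positivity, ?_,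
    fun x => ?_⟩
  · rw [div_pow, div_pow, ← sub_div, hsq, div_eq_one_iff_eq (by rw [← hsq]; positivity)]
    ring
  · rw [poissonFactor, inv_div, norm_sub_sq_real, norm_coe, div_mul_eq_mul_div, ← add_div]
    have : ⟪(x : EuclideanSpace ℝ (Fin (d + 1))), b⟫ =
        ‖b‖ * ⟪e, (x : EuclideanSpace ℝ (Fin (d + 1)))⟫ := by
      conv_lhs => rw [hbe, inner_smul_right, real_inner_comm]
    rw [this]
    ring

/-- `T` is the action of the boost on light rays. The norm of the boosted point is the inverse of
the conformal factor, so the Lorentz form gives the distance formula and the change of variables on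
the sphere gives the measure. -/
theorem exists_measurePreserving (hb : ‖b‖ ≠ 1) :
    ∃ T : UnitSphere d → UnitSphere d, MeasurePreserving T (poissonMeasure b) (unif d) ∧
      ∀ x y, dist (T x) (T y) ^ 2 = dist x y ^ 2 * poissonFactor b x * poissonFactor b y := by
  obtain ⟨e, c, s, he, hc, hcs, hp⟩ := exists_boost_factor (d := d) hb
  have hnb : ∀ x : UnitSphere d, ‖boost e c s x.1‖ = (poissonFactor b x)⁻¹ := fun x => by
    rw [norm_boost he hc hcs, norm_coe, mul_one, hp]
  have hpf := fun x : UnitSphere d => poissonFactor_pos hb x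
  let T : UnitSphere d → UnitSphere d := fun x => ⟨poissonFactor b x • boost e c s x.1, by
    rw [mem_sphere_zero_iff_norm, norm_smul, hnb, Real.norm_of_nonneg (hpf x).le,
      mul_inv_cancel₀ (hpf x).ne']⟩
  have hT : Continuous T := by
    have := continuous_poissonFactor (d := d) hb
    have := continuous_boost (e := e) (c := c) (s := s)
    exact Continuous.subtype_mk (by fun_prop) _
  refine ⟨T, ⟨hT.measurable, ?_⟩, fun x y => ?_⟩
  · ext A hA
    have hA' : MeasurableSet (Subtype.val '' A : Set (EuclideanSpace ℝ (Fin (d + 1)))) :=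
      (MeasurableEmbedding.subtype_coe
        Metric.isClosed_sphere.measurableSet).measurableSet_image.2 hA
    have h := lintegral_toSphere_boost (volume : Measure (EuclideanSpace ℝ (Fin (d + 1))))
      (n := d) (by simp) he hc hcs (g := (Subtype.val '' A).indicator 1)
      (measurable_one.indicator hA')
    have e1 : ∀ ω : UnitSphere d, (Subtype.val '' A).indicator
        (1 : EuclideanSpace ℝ (Fin (d + 1)) → ℝ≥0∞) ω.1 =
        A.indicator 1 ω := fun ω => by
      by_cases hω : ω ∈ A <;> simp [hω]
    have e2 : ∀ ω : UnitSphere d, ENNReal.ofReal (‖boost e c s ω.1‖⁻¹ ^ d) *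
        (Subtype.val '' A).indicator 1 (‖boost e c s ω.1‖⁻¹ • boost e c s ω.1) =
        (T ⁻¹' A).indicator (fun x => ENNReal.ofReal (poissonFactor b x ^ d)) ω := fun ω => by
      have : ‖boost e c s ω.1‖⁻¹ • boost e c s ω.1 = (T ω).1 := by rw [hnb, inv_inv]
      rw [this, e1, hnb, inv_inv]
      by_cases hω : T ω ∈ A <;> simp [hω]
    simp only [e1, e2] at h
    rw [Measure.map_apply hT.measurable hA, poissonMeasure,
      withDensity_apply _ (hT.measurable hA), ← lintegral_indicator (hT.measurable hA), unif,
      lintegral_smul_measure, h, lintegral_indicator_one hA, Measure.smul_apply]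
  · rw [dist_sq, dist_sq]
    simp only [cosSq, T]
    rw [inner_smul_left, inner_smul_right, inner_boost_boost he hcs, norm_coe, norm_coe,
      mul_one, mul_one, hp, hp]
    have h1 := (hpf x).ne'
    have h2 := (hpf y).ne'
    simp only [conj_trivial]
    field_simp
    ring

theorem isProbabilityMeasure_poissonMeasure (hb : ‖b‖ ≠ 1) :
    IsProbabilityMeasure (poissonMeasure b : Measure (UnitSphere d)) := by
  obtain ⟨T, hT, -⟩ := exists_measurePreserving (d := d) hb
  exact ⟨by rw [← Set.preimage_univ (f := T), hT.measure_preimage nullMeasurableSet_univ,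
    measure_univ]⟩

/-- The Poisson measure at `(1 + r) x` has total mass one and density at least `(2 * r)⁻¹ ^ d` on
the ball, which bounds the uniform measure of the ball without any computation of caps. -/
theorem unif_closedBall_le (x : UnitSphere d) {r : ℝ} (hr : 0 < r) :
    unif d (Metric.closedBall x r) ≤ ENNReal.ofReal ((2 * r) ^ d) := by
  let b : EuclideanSpace ℝ (Fin (d + 1)) := (1 + r) • (x : EuclideanSpace ℝ (Fin (d + 1)))
  have hbn : ‖b‖ = 1 + r := by
    rw [norm_smul, norm_coe, mul_one, Real.norm_of_nonneg (by positivity)]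
  have hb : ‖b‖ ≠ 1 := by rw [hbn]; linarith
  have := isProbabilityMeasure_poissonMeasure (d := d) hb
  have hp : ∀ y ∈ Metric.closedBall x r, (2 * r)⁻¹ ≤ poissonFactor b y := by
    intro y hy
    have h1 : ‖(y : EuclideanSpace ℝ (Fin (d + 1))) - b‖ ≤ 2 * r := by
      have : (y : EuclideanSpace ℝ (Fin (d + 1))) - b = (y - x) - r • (x : _) := by
        simp only [b, add_smul, one_smul]; abel
      rw [this]
      refine (norm_sub_le _ _).trans ?_
      rw [norm_smul, norm_coe, Real.norm_of_nonneg hr.le]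
      have := Metric.mem_closedBall.1 hy
      rw [Subtype.dist_eq, dist_eq_norm] at this
      linarith
    have h2 := norm_coe_sub_pos hb y
    rw [poissonFactor, hbn, abs_of_neg (by nlinarith), inv_eq_one_div,
      div_le_div_iff₀ (by positivity)
      (by positivity)]
    have := pow_le_pow_left₀ h2.le h1 2
    nlinarith [pow_pos hr 3]
  have h1 : ENNReal.ofReal ((2 * r)⁻¹ ^ d) * unif d (Metric.closedBall x r) ≤ 1 := by
    rw [← setLIntegral_const]
    calc _ ≤ ∫⁻ y in Metric.closedBall x r, ENNReal.ofReal (poissonFactor b y ^ d) ∂unif d :=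
          setLIntegral_mono' measurableSet_closedBall fun y hy =>
            ENNReal.ofReal_le_ofReal (pow_le_pow_left₀ (by positivity) (hp y hy) d)
      _ ≤ poissonMeasure b Set.univ := by
          rw [poissonMeasure, withDensity_apply _ MeasurableSet.univ, Measure.restrict_univ]
          exact setLIntegral_le_lintegral _ _
      _ = 1 := measure_univ
  calc unif d (Metric.closedBall x r) = ENNReal.ofReal ((2 * r) ^ d) *
        (ENNReal.ofReal ((2 * r)⁻¹ ^ d) * unif d (Metric.closedBall x r)) := by
        rw [← mul_assoc, ← ENNReal.ofReal_mul (by positivity), ← mul_pow,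
          mul_inv_cancel₀ (by positivity), one_pow, ENNReal.ofReal_one, one_mul]
    _ ≤ ENNReal.ofReal ((2 * r) ^ d) * 1 := by gcongr
    _ = _ := mul_one _

/-- Dyadic layers: the number of balls of radius `2 / 2 ^ n` that contain `y` exceeds the base-two
logarithm of `2 / dist x y`. -/
theorem logKer_le_tsum (x y : UnitSphere d) :
    logKer x y ≤ ∑' n : ℕ, (Metric.closedBall x (2 / 2 ^ n)).indicator
      (fun _ => ENNReal.ofReal (Real.log 2)) y := by
  have hl2 : 0 < Real.log 2 := Real.log_pos one_lt_two
  by_cases h : x = y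
  · subst h
    have : ∀ n : ℕ, (Metric.closedBall x (2 / 2 ^ n)).indicator
        (fun _ => ENNReal.ofReal (Real.log 2)) x = ENNReal.ofReal (Real.log 2) := fun n =>
      Set.indicator_of_mem (Metric.mem_closedBall_self (by positivity)) _
    simp only [this]
    rw [ENNReal.tsum_const_eq_top_of_ne_zero (ENNReal.ofReal_pos.2 hl2).ne']
    exact le_top
  · rw [logKer_of_ne h]
    have hd : 0 < dist x y := dist_pos.2 h
    set t := Real.log 2 - Real.log (dist x y) with ht
    have ht0 : 0 ≤ t := log_two_sub_log_dist_nonneg h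
    set N := ⌊t / Real.log 2⌋₊ with hN
    have hmem : ∀ n ∈ Finset.range (N + 1), (Metric.closedBall x (2 / 2 ^ n)).indicator
        (fun _ => ENNReal.ofReal (Real.log 2)) y = ENNReal.ofReal (Real.log 2) := by
      intro n hn
      refine Set.indicator_of_mem ?_ _
      rw [Metric.mem_closedBall, dist_comm, ← Real.log_le_log_iff hd (by positivity),
        Real.log_div (by norm_num) (by positivity), Real.log_pow]
      have h1 : (n : ℝ) ≤ t / Real.log 2 :=
        (Nat.cast_le.2 (Nat.lt_succ_iff.1 (Finset.mem_range.1 hn))).trans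
          (Nat.floor_le (div_nonneg ht0 hl2.le))
      rw [le_div_iff₀ hl2] at h1
      linarith
    refine le_trans ?_ (ENNReal.sum_le_tsum (Finset.range (N + 1)))
    rw [Finset.sum_congr rfl hmem, Finset.sum_const, Finset.card_range, nsmul_eq_mul,
      ← ENNReal.ofReal_natCast, ← ENNReal.ofReal_mul (by positivity)]
    refine ENNReal.ofReal_le_ofReal ?_
    have := (Nat.lt_floor_add_one (t / Real.log 2)).le
    rw [div_le_iff₀ hl2] at this
    exact_mod_cast this

theorem pot_unif_ne_top (hd : 1 ≤ d) (x : UnitSphere d) : pot (unif d) x ≠ ⊤ := by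
  have hs : Summable fun n : ℕ => Real.log 2 * ((4 / 2 ^ n) ^ d : ℝ) := by
    refine Summable.mul_left _ ?_
    have h1 : ∀ n : ℕ, ((4 / 2 ^ n) ^ d : ℝ) = 4 ^ d * ((1 / 2) ^ d) ^ n := fun n => by
      rw [div_pow, div_eq_mul_inv, ← pow_mul, ← pow_mul, mul_comm d n, one_div, inv_pow]
    simp only [h1]
    exact (summable_geometric_of_lt_one (by positivity)
      (pow_lt_one₀ (by norm_num) (by norm_num) (by omega))).mul_left _
  have hle : pot (unif d) x ≤ ∑' n : ℕ, ENNReal.ofReal (Real.log 2 * ((4 / 2 ^ n) ^ d : ℝ)) := by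
    refine (lintegral_mono (logKer_le_tsum x)).trans ?_
    rw [lintegral_tsum fun n => (measurable_const.indicator measurableSet_closedBall).aemeasurable]
    refine ENNReal.tsum_le_tsum fun n => ?_
    rw [lintegral_indicator_const measurableSet_closedBall,
      ENNReal.ofReal_mul (Real.log_nonneg one_le_two)]
    gcongr
    refine (unif_closedBall_le x (by positivity)).trans_eq ?_
    congr 2
    ring
  exact (hle.trans_lt hs.tsum_ofReal_lt_top).ne

/-- The surface measure of a set is a multiple of the volume of the cone over it, and a linear
isometry preserves volume and commutes with forming cones. -/
theorem measurePreserving_isometry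
    (L : EuclideanSpace ℝ (Fin (d + 1)) ≃ₗᵢ[ℝ] EuclideanSpace ℝ (Fin (d + 1)))
    (T : UnitSphere d → UnitSphere d) (hT : ∀ x, (T x).1 = L x.1) :
    MeasurePreserving T (unif d) (unif d) := by
  have hTm : Measurable T := by
    have : Continuous T := by
      refine continuous_induced_rng.2 ?_
      simp only [Function.comp_def, hT]
      fun_prop
    exact this.measurable
  refine ⟨hTm, ?_⟩
  ext A hA
  rw [Measure.map_apply hTm hA, unif, Measure.smul_apply, Measure.smul_apply,
    Measure.toSphere_apply' _ (hTm hA), Measure.toSphere_apply' _ hA]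
  have : Set.Ioo (0 : ℝ) 1 • (Subtype.val '' (T ⁻¹' A)) =
      L ⁻¹' (Set.Ioo (0 : ℝ) 1 • (Subtype.val '' A)) := by
    ext y
    simp only [Set.mem_smul, Set.mem_image, Set.mem_preimage]
    constructor
    · rintro ⟨r, hr, _, ⟨x, hx, rfl⟩, rfl⟩
      exact ⟨r, hr, _, ⟨T x, hx, rfl⟩, by rw [hT, map_smul]⟩
    · rintro ⟨r, hr, _, ⟨x, hx, rfl⟩, hy⟩
      have hx1 : L.symm x.1 ∈ Metric.sphere (0 : EuclideanSpace ℝ (Fin (d + 1))) 1 := by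
        rw [mem_sphere_zero_iff_norm, LinearIsometryEquiv.norm_map, norm_coe]
      have hTx : T ⟨L.symm x.1, hx1⟩ = x := Subtype.ext (by rw [hT]; simp)
      refine ⟨r, hr, _, ⟨⟨L.symm x.1, hx1⟩, by rwa [hTx], rfl⟩, ?_⟩
      rw [← map_smul, hy, LinearIsometryEquiv.symm_apply_apply]
  have hvol := L.measurePreserving.measure_preimage_emb
    L.toHomeomorph.measurableEmbedding (Set.Ioo (0 : ℝ) 1 • (Subtype.val '' A))
  rw [this, hvol]

theorem pot_unif_eq (x y : UnitSphere d) : pot (unif d) x = pot (unif d) y := by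
  -- The reflection in the hyperplane orthogonal to `x - y` exchanges the two points and preserves
  -- kernel and measure.
  let L := (ℝ ∙ ((x : EuclideanSpace ℝ (Fin (d + 1))) - y))ᗮ.reflection
  have hL : L x = y := Submodule.reflection_sub (by rw [norm_coe, norm_coe])
  let T : UnitSphere d → UnitSphere d := fun z => ⟨L z.1, by
    rw [mem_sphere_zero_iff_norm, LinearIsometryEquiv.norm_map, norm_coe]⟩
  have hT := measurePreserving_isometry L T fun _ => rfl
  have hTx : T x = y := Subtype.ext hL
  have hk : ∀ z w, logKer (T z) (T w) = logKer z w := fun z w => by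
    simp only [logKer, cosSq, T, LinearIsometryEquiv.inner_map_map]
  rw [pot, pot, ← hT.lintegral_comp (measurable_logKer_left y), ← hTx]
  simp only [hk]

theorem poissonMeasure_le_smul_unif (hb : ‖b‖ ≠ 1) :
    ∃ K : ℝ≥0∞, K ≠ ⊤ ∧ (poissonMeasure b : Measure (UnitSphere d)) ≤ K • unif d := by
  obtain ⟨M, hM⟩ := (isCompact_range ((continuous_poissonFactor (d := d) hb).pow d)).bddAbove
  refine ⟨ENNReal.ofReal M, ENNReal.ofReal_ne_top, ?_⟩
  rw [← withDensity_const]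
  exact withDensity_mono (ae_of_all _ fun x => ENNReal.ofReal_le_ofReal (hM ⟨x, rfl⟩))

theorem poissonMeasure_absolutelyContinuous : poissonMeasure b ≪ unif d :=
  withDensity_absolutelyContinuous _ _

theorem pot_poissonMeasure_ne_top (hd : 1 ≤ d) (hb : ‖b‖ ≠ 1) (x : UnitSphere d) :
    pot (poissonMeasure b) x ≠ ⊤ := by
  obtain ⟨K, hK, hle⟩ := poissonMeasure_le_smul_unif (d := d) hb
  refine ((pot_mono hle x).trans_lt ?_).ne
  rw [pot_smul]
  exact ENNReal.mul_lt_top hK.lt_top (pot_unif_ne_top hd x).lt_top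

theorem ae_ne_of_pot_ne_top {μ : Measure (UnitSphere d)} {x : UnitSphere d}
    (h : pot μ x ≠ ⊤) : ∀ᵐ y ∂μ, x ≠ y := by
  filter_upwards [ae_lt_top (measurable_logKer_left x) h] with y hy
  rintro rfl
  rw [logKer_self] at hy
  exact lt_irrefl _ hy

/-- The potential of the balayage of a unit charge is that of the charge, up to a constant. -/
theorem toReal_pot_poissonMeasure (hd : 1 ≤ d) (hb : ‖b‖ ≠ 1) :
    ∃ C : ℝ, ∀ x : UnitSphere d, (pot (poissonMeasure b) x).toReal =
      C - Real.log ‖(x : EuclideanSpace ℝ (Fin (d + 1))) - b‖ := by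
  have := isProbabilityMeasure_poissonMeasure (d := d) hb
  obtain ⟨T, hT, hdist⟩ := exists_measurePreserving (d := d) hb
  have hp := fun x : UnitSphere d => poissonFactor_pos hb x
  have x₀ : UnitSphere d := ⟨EuclideanSpace.single 0 1, by simp⟩
  refine ⟨(pot (unif d) x₀).toReal + 1 / 2 * Real.log |1 - ‖b‖ ^ 2| +
    ∫ y, 1 / 2 * Real.log (poissonFactor b y) ∂poissonMeasure b, fun x => ?_⟩
  -- This is the logarithm of the distance formula. The diagonal is excluded because `toReal` sends
  -- the infinite value to `0`; it is a null set because the potential at `x` is finite.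
  have hrel : ∀ y, x ≠ y → (logKer x y).toReal = (logKer (T x) (T y)).toReal +
      1 / 2 * Real.log (poissonFactor b x) + 1 / 2 * Real.log (poissonFactor b y) := by
    intro y hxy
    have h0 : 0 < dist x y := dist_pos.2 hxy
    have h1 : 0 < dist (T x) (T y) := by
      have : 0 < dist (T x) (T y) ^ 2 := by rw [hdist]; have := hp x; have := hp y; positivity
      exact lt_of_le_of_ne dist_nonneg fun h => by rw [← h] at this; simp at this
    have hT' : T x ≠ T y := dist_pos.1 h1
    rw [logKer_of_ne hxy, logKer_of_ne hT', ENNReal.toReal_ofReal (log_two_sub_log_dist_nonneg hxy),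
      ENNReal.toReal_ofReal (log_two_sub_log_dist_nonneg hT')]
    have := congrArg Real.log (hdist x y)
    rw [Real.log_pow, Real.log_mul (mul_pos (pow_pos h0 2) (hp x)).ne' (hp y).ne',
      Real.log_mul (pow_pos h0 2).ne' (hp x).ne', Real.log_pow] at this
    push_cast at this
    linarith
  have hae := ae_ne_of_pot_ne_top (pot_poissonMeasure_ne_top (d := d) hd hb x)
  have hm := measurable_logKer_left (d := d)
  have hmT : Measurable fun y => logKer (T x) (T y) := (hm (T x)).comp hT.measurable
  have hfinT : ∫⁻ y, logKer (T x) (T y) ∂poissonMeasure b ≠ ⊤ := by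
    rw [hT.lintegral_comp (hm (T x))]
    exact pot_unif_ne_top hd (T x)
  have hlogp : Integrable (fun y => 1 / 2 * Real.log (poissonFactor b y)) (poissonMeasure b) :=
    (((continuous_poissonFactor hb).log fun y => (hp y).ne').const_mul
      (1 / 2 : ℝ)).integrable_of_compactSpace _
  have hintT : Integrable (fun y => (logKer (T x) (T y)).toReal) (poissonMeasure b) :=
    integrable_toReal_of_lintegral_ne_top hmT.aemeasurable hfinT
  have hsum : Integrable (fun y => (logKer (T x) (T y)).toReal +
      1 / 2 * Real.log (poissonFactor b x)) (poissonMeasure b) := hintT.add (integrable_const _)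
  rw [pot, ← integral_toReal (hm x).aemeasurable
    (ae_lt_top (hm x) (pot_poissonMeasure_ne_top hd hb x)),
    integral_congr_ae (hae.mono hrel), integral_add hsum hlogp,
    integral_add hintT (integrable_const _), integral_const, probReal_univ, one_smul,
    integral_toReal hmT.aemeasurable (ae_lt_top hmT hfinT)]
  rw [hT.lintegral_comp (hm (T x))]
  have h1 : ∫⁻ y, logKer (T x) y ∂unif d = pot (unif d) x₀ := pot_unif_eq (T x) x₀
  have h2 : Real.log (poissonFactor b x) = Real.log |1 - ‖b‖ ^ 2| -
      2 * Real.log ‖(x : EuclideanSpace ℝ (Fin (d + 1))) - b‖ := by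
    rw [poissonFactor, Real.log_div (abs_one_sub_sq_pos hb).ne'
      (pow_pos (norm_coe_sub_pos hb x) 2).ne', Real.log_pow]
    push_cast; ring
  rw [h1, h2]
  ring

end UnitSphere

/-! ### Measures are determined by their logarithmic potentials inside the ball -/

theorem eq_zero_of_hasSum_pow_zero {c : ℕ → ℝ} {M : ℝ} (hM : ∀ k, |c k| ≤ M)
    (h : ∀ s : ℝ, 0 < s → s < 1 → HasSum (fun k => c k * s ^ k) 0) (n : ℕ) : c n = 0 := by
  induction n using Nat.strong_induction_on with
  | _ n ih =>
    have hM0 : 0 ≤ M := (abs_nonneg _).trans (hM 0)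
    -- The lower coefficients vanish by induction; dividing the series by `s ^ n` leaves `c n` plus
    -- a tail of order `s`.
    have key : ∀ s : ℝ, 0 < s → s < 1 → |c n| ≤ s * (M * (1 - s)⁻¹) := by
      intro s hs hs1
      have h1 := (hasSum_nat_add_iff' (n + 1)).2 (h s hs hs1)
      have h2 : ∑ i ∈ Finset.range (n + 1), c i * s ^ i = c n * s ^ n := by
        rw [Finset.sum_range_succ, Finset.sum_eq_zero, zero_add]
        intro i hi
        rw [ih i (Finset.mem_range.1 hi), zero_mul]
      rw [h2, zero_sub] at h1
      have h3 : HasSum (fun k => s ^ (n + 1) * M * s ^ k) (s ^ (n + 1) * M * (1 - s)⁻¹) :=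
        (hasSum_geometric_of_lt_one hs.le hs1).mul_left _
      have h4 : |-(c n * s ^ n)| ≤ s ^ (n + 1) * M * (1 - s)⁻¹ := by
        rw [← Real.norm_eq_abs]
        refine h1.norm_le_of_bounded h3 fun k => ?_
        rw [Real.norm_eq_abs, abs_mul, abs_of_nonneg (pow_nonneg hs.le _)]
        calc |c (k + (n + 1))| * s ^ (k + (n + 1)) ≤ M * s ^ (k + (n + 1)) := by
              gcongr; exact hM _
          _ = s ^ (n + 1) * M * s ^ k := by ring
      rw [abs_neg, abs_mul, abs_of_nonneg (pow_nonneg hs.le n)] at h4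
      refine le_of_mul_le_mul_right (h4.trans_eq ?_) (pow_pos hs n)
      ring
    have hlim : Tendsto (fun s : ℝ => s * (M * (1 - s)⁻¹)) (𝓝[>] 0) (𝓝 (0 * (M * (1 - 0)⁻¹))) := by
      have : ContinuousAt (fun s : ℝ => s * (M * (1 - s)⁻¹)) 0 := by
        have : (1 - (0 : ℝ)) ≠ 0 := by norm_num
        fun_prop (disch := assumption)
      exact this.tendsto.mono_left nhdsWithin_le_nhds
    rw [zero_mul] at hlim
    have : |c n| ≤ 0 := ge_of_tendsto hlim (by
      filter_upwards [Ioo_mem_nhdsGT (zero_lt_one' ℝ)] with s hs using key s hs.1 hs.2)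
    exact abs_eq_zero.1 (le_antisymm this (abs_nonneg _))

namespace UnitSphere

variable {d : ℕ}

theorem abs_inner_le (x : UnitSphere d) (u : EuclideanSpace ℝ (Fin (d + 1))) :
    |⟪(x : EuclideanSpace ℝ (Fin (d + 1))), u⟫| ≤ ‖u‖ := by
  have := abs_real_inner_le_norm (x : EuclideanSpace ℝ (Fin (d + 1))) u
  rwa [norm_coe, one_mul] at this

theorem hasSum_integral_log (μ : Measure (UnitSphere d)) [IsFiniteMeasure μ]
    {u : EuclideanSpace ℝ (Fin (d + 1))} (hu : ‖u‖ = 1) {s : ℝ} (hs : 0 < s) (hs1 : s < 1) :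
    HasSum (fun k : ℕ => s ^ (k + 1) / (k + 1) *
        ∫ x, ⟪(x : EuclideanSpace ℝ (Fin (d + 1))), u⟫ ^ (k + 1) ∂μ)
      (∫ x, -Real.log (1 - s * ⟪(x : EuclideanSpace ℝ (Fin (d + 1))), u⟫) ∂μ) := by
  let F : ℕ → UnitSphere d → ℝ := fun k x =>
    (s * ⟪(x : EuclideanSpace ℝ (Fin (d + 1))), u⟫) ^ (k + 1) / (k + 1)
  have hF : ∀ k, Continuous (F k) := fun k => by
    simp only [F]
    fun_prop
  have hst : ∀ x : UnitSphere d, |s * ⟪(x : EuclideanSpace ℝ (Fin (d + 1))), u⟫| ≤ s := by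
    intro x
    rw [abs_mul, abs_of_pos hs]
    exact mul_le_of_le_one_right hs.le ((abs_inner_le x u).trans_eq hu)
  have hb : ∀ k x, ‖F k x‖ ≤ s * s ^ k := by
    intro k x
    simp only [F]
    rw [Real.norm_eq_abs, abs_div, abs_pow, abs_of_pos (by positivity : (0 : ℝ) < k + 1)]
    refine (div_le_self (by positivity) (by linarith [(Nat.cast_nonneg k : (0 : ℝ) ≤ k)])).trans ?_
    rw [← pow_succ']
    exact pow_le_pow_left₀ (abs_nonneg _) (hst x) _
  have h := hasSum_integral_of_summable_integral_norm (μ := μ) (F := F)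
    (fun k => (hF k).integrable_of_compactSpace μ) (by
      refine Summable.of_nonneg_of_le (fun k => integral_nonneg fun x => norm_nonneg _)
        (fun k => integral_mono ((hF k).norm.integrable_of_compactSpace μ)
          (integrable_const _) (hb k)) ?_
      simp only [integral_const]
      exact ((summable_geometric_of_lt_one hs.le hs1).mul_left s).const_smul _)
  have e1 : ∀ x : UnitSphere d, ∑' k, F k x =
      -Real.log (1 - s * ⟪(x : EuclideanSpace ℝ (Fin (d + 1))), u⟫) := fun x =>
    (Real.hasSum_pow_div_log_of_abs_lt_one ((hst x).trans_lt hs1)).tsum_eq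
  rw [integral_congr_ae (ae_of_all _ e1)] at h
  have e2 : ∀ k : ℕ, s ^ (k + 1) / (k + 1) *
      ∫ x, ⟪(x : EuclideanSpace ℝ (Fin (d + 1))), u⟫ ^ (k + 1) ∂μ = ∫ x, F k x ∂μ := by
    intro k
    rw [← integral_const_mul]
    refine integral_congr_ae (ae_of_all _ fun x => ?_)
    simp only [F]
    rw [mul_pow]
    ring
  simpa only [e2] using h

theorem continuous_log_norm_sub {b : EuclideanSpace ℝ (Fin (d + 1))} (hb : ‖b‖ ≠ 1) :
    Continuous fun x : UnitSphere d =>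
      Real.log ‖(x : EuclideanSpace ℝ (Fin (d + 1))) - b‖ := by
  refine Continuous.log (by fun_prop) fun x => (norm_coe_sub_pos hb x).ne'

theorem log_norm_sub_smul {u : EuclideanSpace ℝ (Fin (d + 1))} (hu : ‖u‖ = 1) {s : ℝ}
    (hs : 0 < s) (hs1 : s < 1) : ∃ (b : EuclideanSpace ℝ (Fin (d + 1))) (C : ℝ), ‖b‖ < 1 ∧
      ∀ x : UnitSphere d, -Real.log (1 - s * ⟪(x : EuclideanSpace ℝ (Fin (d + 1))), u⟫) =
        C - 2 * Real.log ‖(x : EuclideanSpace ℝ (Fin (d + 1))) - b‖ := by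
  have hw : 0 ≤ 1 - s ^ 2 := by nlinarith
  set w := √(1 - s ^ 2) with hwdef
  have hw0 : 0 ≤ w := Real.sqrt_nonneg _
  have hw2 : w ^ 2 = 1 - s ^ 2 := Real.sq_sqrt hw
  have hbn : ‖(s / (1 + w)) • u‖ = s / (1 + w) := by
    rw [norm_smul, hu, mul_one, Real.norm_of_nonneg (by positivity)]
  have hlt : s / (1 + w) < 1 := by
    rw [div_lt_one (by positivity)]; linarith
  -- The radius `r = s / (1 + w)` is the root inside the ball of `2 r / (1 + r²) = s`, and then `1 +
  -- r² = 2 / (1 + w)`.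
  refine ⟨(s / (1 + w)) • u, Real.log (2 / (1 + w)), hbn.trans_lt hlt, fun x => ?_⟩
  have hpos : 0 < 1 - s * ⟪(x : EuclideanSpace ℝ (Fin (d + 1))), u⟫ := by
    have h1 := (le_abs_self _).trans ((abs_inner_le x u).trans_eq hu)
    nlinarith
  have hsq : ‖(x : EuclideanSpace ℝ (Fin (d + 1))) - (s / (1 + w)) • u‖ ^ 2 =
      2 / (1 + w) * (1 - s * ⟪(x : EuclideanSpace ℝ (Fin (d + 1))), u⟫) := by
    rw [norm_sub_sq_real, norm_coe, hbn, inner_smul_right]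
    field_simp
    linear_combination hw2
  have := congrArg Real.log hsq
  rw [Real.log_pow, Real.log_mul (by positivity) hpos.ne'] at this
  push_cast at this
  linarith

/-- Finite measures on the sphere are determined by their mass and their potentials inside. -/
theorem measure_ext_of_log {μ ν : Measure (UnitSphere d)} [IsFiniteMeasure μ] [IsFiniteMeasure ν]
    (hm : μ.real Set.univ = ν.real Set.univ)
    (h : ∀ b : EuclideanSpace ℝ (Fin (d + 1)), ‖b‖ < 1 →
      ∫ x, Real.log ‖(x : EuclideanSpace ℝ (Fin (d + 1))) - b‖ ∂μ =
      ∫ x, Real.log ‖(x : EuclideanSpace ℝ (Fin (d + 1))) - b‖ ∂ν) : μ = ν := by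
  have hunit : ∀ u : EuclideanSpace ℝ (Fin (d + 1)), ‖u‖ = 1 → ∀ k : ℕ,
      ∫ x, ⟪(x : EuclideanSpace ℝ (Fin (d + 1))), u⟫ ^ (k + 1) ∂μ =
      ∫ x, ⟪(x : EuclideanSpace ℝ (Fin (d + 1))), u⟫ ^ (k + 1) ∂ν := by
    intro u hu k
    have hbd : ∀ (ρ : Measure (UnitSphere d)) [IsFiniteMeasure ρ] (k : ℕ),
        |∫ x, ⟪(x : EuclideanSpace ℝ (Fin (d + 1))), u⟫ ^ (k + 1) ∂ρ| ≤ ρ.real Set.univ := by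
      intro ρ _ k
      have := norm_integral_le_of_norm_le_const (μ := ρ) (C := 1)
        (f := fun x => ⟪(x : EuclideanSpace ℝ (Fin (d + 1))), u⟫ ^ (k + 1))
        (ae_of_all _ fun x => by
          rw [norm_pow, Real.norm_eq_abs]
          exact pow_le_one₀ (abs_nonneg _) ((abs_inner_le x u).trans_eq hu))
      rwa [one_mul, Real.norm_eq_abs] at this
    have key := eq_zero_of_hasSum_pow_zero (M := μ.real Set.univ + ν.real Set.univ)
      (c := fun k : ℕ => (∫ x, ⟪(x : EuclideanSpace ℝ (Fin (d + 1))), u⟫ ^ (k + 1) ∂μ -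
        ∫ x, ⟪(x : EuclideanSpace ℝ (Fin (d + 1))), u⟫ ^ (k + 1) ∂ν) / (k + 1)) (by
        intro k
        rw [abs_div, abs_of_pos (by positivity : (0 : ℝ) < k + 1)]
        refine (div_le_self (abs_nonneg _)
          (by linarith [(Nat.cast_nonneg k : (0 : ℝ) ≤ k)])).trans ?_
        exact (abs_sub _ _).trans (add_le_add (hbd μ k) (hbd ν k))) (by
        intro s hs hs1
        obtain ⟨b, C, hb, hlog⟩ := log_norm_sub_smul hu hs hs1
        have hi : ∀ (ρ : Measure (UnitSphere d)) [IsFiniteMeasure ρ],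
            ∫ x, -Real.log (1 - s * ⟪(x : EuclideanSpace ℝ (Fin (d + 1))), u⟫) ∂ρ =
              ρ.real Set.univ * C -
                2 * ∫ x, Real.log ‖(x : EuclideanSpace ℝ (Fin (d + 1))) - b‖ ∂ρ := by
          intro ρ _
          simp only [hlog]
          rw [integral_sub (integrable_const _)
            (((continuous_log_norm_sub hb.ne).integrable_of_compactSpace ρ).const_mul 2),
            integral_const, integral_const_mul, smul_eq_mul]
        have h1 := (hasSum_integral_log μ hu hs hs1).sub (hasSum_integral_log ν hu hs hs1)
        rw [hi, hi, hm, h b hb, sub_self] at h1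
        have h2 := h1.mul_left s⁻¹
        rw [mul_zero] at h2
        refine h2.congr_fun fun j => ?_
        have hj : (0 : ℝ) < j + 1 := by positivity
        rw [pow_succ s]
        field_simp) k
    have hk : (0 : ℝ) < k + 1 := by positivity
    exact sub_eq_zero.1 ((div_eq_zero_iff.1 key).resolve_right hk.ne')
  refine measure_ext_of_moments fun u k => ?_
  cases k with
  | zero => simpa using hm
  | succ k =>
    by_cases hu : u = 0
    · simp [hu]
    · have h1 := hunit (‖u‖⁻¹ • u) (by simp [norm_smul, hu]) k
      simp only [inner_smul_right, mul_pow, integral_const_mul] at h1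
      exact mul_left_cancel₀ (pow_ne_zero _ (inv_ne_zero (norm_ne_zero_iff.2 hu))) h1

/-- The potential of a Poisson measure is continuous, so by symmetry the potential of any finite
measure, even one of infinite energy, is integrable against it. -/
theorem mutEnergy_poissonMeasure (hd : 1 ≤ d) {b : EuclideanSpace ℝ (Fin (d + 1))}
    (hb : ‖b‖ ≠ 1) : ∃ C : ℝ, ∀ (μ : Measure (UnitSphere d)) [IsFiniteMeasure μ],
      mutEnergy (poissonMeasure b) μ ≠ ⊤ ∧ (mutEnergy (poissonMeasure b) μ).toReal =
        C * μ.real Set.univ -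
          ∫ x, Real.log ‖(x : EuclideanSpace ℝ (Fin (d + 1))) - b‖ ∂μ := by
  have := isProbabilityMeasure_poissonMeasure (d := d) hb
  obtain ⟨C, hC⟩ := toReal_pot_poissonMeasure hd hb
  have hpot := fun x => (ENNReal.ofReal_toReal (pot_poissonMeasure_ne_top hd hb x)).symm
  refine ⟨C, fun μ _ => ?_⟩
  have hcont : Continuous fun x : UnitSphere d =>
      C - Real.log ‖(x : EuclideanSpace ℝ (Fin (d + 1))) - b‖ :=
    continuous_const.sub (continuous_log_norm_sub hb)
  have hnn : ∀ x : UnitSphere d, 0 ≤ C - Real.log ‖(x : EuclideanSpace ℝ (Fin (d + 1))) - b‖ :=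
    fun x => by rw [← hC]; exact ENNReal.toReal_nonneg
  have hE : mutEnergy (poissonMeasure b) μ = ENNReal.ofReal
      (∫ x, (C - Real.log ‖(x : EuclideanSpace ℝ (Fin (d + 1))) - b‖) ∂μ) := by
    rw [mutEnergy_comm, mutEnergy, lintegral_congr hpot]
    simp only [hC]
    rw [ofReal_integral_eq_lintegral_ofReal (hcont.integrable_of_compactSpace μ)
      (ae_of_all _ hnn)]
  rw [hE, ENNReal.toReal_ofReal (integral_nonneg hnn), integral_sub (integrable_const _)
    ((continuous_log_norm_sub hb).integrable_of_compactSpace μ), integral_const, smul_eq_mul,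
    mul_comm]
  exact ⟨ENNReal.ofReal_ne_top, rfl⟩

/-- A measure `p - n` of mass one, whose weighted potential is constant almost everywhere, is
determined by the field. -/
theorem add_eq_add_of_ae_const (hd : 1 ≤ d) {Q : UnitSphere d → ℝ} (hQ : Continuous Q)
    {p n p' n' : Measure (UnitSphere d)} [IsFiniteMeasure p] [IsFiniteMeasure n]
    [IsFiniteMeasure p'] [IsFiniteMeasure n'] {G G' : ℝ}
    (hm : p.real Set.univ - n.real Set.univ = 1) (hm' : p'.real Set.univ - n'.real Set.univ = 1)
    (h : ∀ᵐ x ∂unif d, (pot p x).toReal - (pot n x).toReal + Q x = G)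
    (h' : ∀ᵐ x ∂unif d, (pot p' x).toReal - (pot n' x).toReal + Q x = G') :
    p + n' = p' + n := by
  -- Integrating the weighted potential against the Poisson measure at `b`, which is absolutely
  -- continuous with respect to `unif d`, evaluates the logarithmic potential of `p - n` at `b`. The
  -- number `B` does not depend on the measures.
  have key : ∀ b : EuclideanSpace ℝ (Fin (d + 1)), ‖b‖ ≠ 1 → ∃ B : ℝ,
      ∀ (p n : Measure (UnitSphere d)) [IsFiniteMeasure p] [IsFiniteMeasure n] (G : ℝ),
      p.real Set.univ - n.real Set.univ = 1 →
      (∀ᵐ x ∂unif d, (pot p x).toReal - (pot n x).toReal + Q x = G) →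
      ∫ x, Real.log ‖(x : EuclideanSpace ℝ (Fin (d + 1))) - b‖ ∂p -
        ∫ x, Real.log ‖(x : EuclideanSpace ℝ (Fin (d + 1))) - b‖ ∂n = B - G := by
    intro b hb
    have := isProbabilityMeasure_poissonMeasure (d := d) hb
    obtain ⟨C, hC⟩ := mutEnergy_poissonMeasure hd hb
    refine ⟨C + ∫ x, Q x ∂poissonMeasure b, fun p n _ _ G hm h => ?_⟩
    have hi : ∀ (μ : Measure (UnitSphere d)) [IsFiniteMeasure μ],
        Integrable (fun x => (pot μ x).toReal) (poissonMeasure b) := fun μ _ =>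
      integrable_toReal_of_lintegral_ne_top (measurable_pot μ).aemeasurable (hC μ).1
    have hv : ∀ (μ : Measure (UnitSphere d)) [IsFiniteMeasure μ],
        ∫ x, (pot μ x).toReal ∂poissonMeasure b = C * μ.real Set.univ -
          ∫ x, Real.log ‖(x : EuclideanSpace ℝ (Fin (d + 1))) - b‖ ∂μ := fun μ _ => by
      rw [integral_toReal (measurable_pot μ).aemeasurable
        (ae_lt_top (measurable_pot μ) (hC μ).1)]
      exact (hC μ).2
    have h1 := integral_congr_ae (poissonMeasure_absolutelyContinuous.ae_le h :
      ∀ᵐ x ∂poissonMeasure b, (pot p x).toReal - (pot n x).toReal + Q x = G)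
    have hpn : Integrable (fun x => (pot p x).toReal - (pot n x).toReal) (poissonMeasure b) :=
      (hi p).sub (hi n)
    rw [integral_add hpn (hQ.integrable_of_compactSpace _),
      integral_sub (hi p) (hi n), hv, hv, integral_const,
      probReal_univ (μ := poissonMeasure b), one_smul] at h1
    linear_combination -h1 + C * hm
  -- At the centre `log ‖x - b‖` vanishes on the sphere, so the constant is forced.
  have hGG : G = G' := by
    obtain ⟨B, hB⟩ := key 0 (by simp)
    have h1 := hB p n G hm h
    have h2 := hB p' n' G' hm' h'
    simp only [sub_zero, norm_coe, Real.log_one, integral_zero] at h1 h2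
    linarith
  refine measure_ext_of_log ?_ fun b hb => ?_
  · rw [measureReal_add_apply, measureReal_add_apply]
    linarith
  · obtain ⟨B, hB⟩ := key b hb.ne
    have h1 := hB p n G hm h
    have h2 := hB p' n' G' hm' h'
    have hi := fun (μ : Measure (UnitSphere d)) (_ : IsFiniteMeasure μ) =>
      (continuous_log_norm_sub hb.ne).integrable_of_compactSpace μ
    rw [integral_add_measure (hi _ inferInstance) (hi _ inferInstance),
      integral_add_measure (hi _ inferInstance) (hi _ inferInstance)]
    linarith

end UnitSphere

/-! ### Differences of measures and their Jordan decompositions -/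

section Signed

variable {X : Type*} [MeasurableSpace X]

theorem measure_ext_of_real {μ ν : Measure X} [IsFiniteMeasure μ] [IsFiniteMeasure ν]
    (h : ∀ A, MeasurableSet A → μ.real A = ν.real A) : μ = ν := by
  ext A hA
  exact (measureReal_eq_measureReal_iff).1 (h A hA)

theorem signedMeasure_apply_eq_sub (s : SignedMeasure X) {A : Set X} (hA : MeasurableSet A) :
    s A = s.toJordanDecomposition.posPart.real A - s.toJordanDecomposition.negPart.real A := by
  conv_lhs => rw [← s.toSignedMeasure_toJordanDecomposition]
  rw [JordanDecomposition.toSignedMeasure, Measure.toSignedMeasure_sub_apply hA]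

/-- Together with `posPart_le`, this transfers potentials from an arbitrary representation `p - n`
to the Jordan decomposition, without proving `p` and `n` mutually singular. -/
theorem posPart_add_eq_add_negPart (p n : Measure X) [IsFiniteMeasure p] [IsFiniteMeasure n] :
    (p.toSignedMeasure - n.toSignedMeasure).toJordanDecomposition.posPart + n =
      p + (p.toSignedMeasure - n.toSignedMeasure).toJordanDecomposition.negPart := by
  refine measure_ext_of_real fun A hA => ?_
  have h := signedMeasure_apply_eq_sub (p.toSignedMeasure - n.toSignedMeasure) hA
  rw [Measure.toSignedMeasure_sub_apply hA] at h
  rw [measureReal_add_apply, measureReal_add_apply]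
  linarith

theorem posPart_le (p n : Measure X) [IsFiniteMeasure p] [IsFiniteMeasure n] :
    (p.toSignedMeasure - n.toSignedMeasure).toJordanDecomposition.posPart ≤ p := by
  obtain ⟨i, hi, hi₂, hi₃, hP, -⟩ :=
    (p.toSignedMeasure - n.toSignedMeasure).toJordanDecomposition_spec
  refine Measure.le_iff.2 fun A hA => ?_
  rw [← ENNReal.toReal_le_toReal (measure_ne_top _ _) (measure_ne_top _ _), ← measureReal_def,
    ← measureReal_def, hP, SignedMeasure.toMeasureOfZeroLE_real_apply _ hi₂ hi hA,
    Measure.toSignedMeasure_sub_apply (hi.inter hA)]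
  have h1 : p.real (i ∩ A) ≤ p.real A := measureReal_mono Set.inter_subset_right
  have h2 : 0 ≤ n.real (i ∩ A) := measureReal_nonneg
  linarith

end Signed

/-! ### The signed equilibrium in terms of the nonnegative kernel -/

namespace UnitSphere

variable {d : ℕ} {a : EuclideanSpace ℝ (Fin (d + 1))} {q : ℝ}

theorem logPotential_ne_top_iff (μ : Measure (UnitSphere d)) [IsFiniteMeasure μ]
    (x : UnitSphere d) : logPotential μ x ≠ ⊤ ↔ pot μ x ≠ ⊤ := by
  rw [logPotential_eq]
  constructor
  · intro h h'
    rw [h', EReal.coe_ennreal_top, EReal.top_sub_coe] at h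
    exact h rfl
  · intro h
    rw [← EReal.coe_ennreal_toReal h, ← EReal.coe_sub]
    exact EReal.coe_ne_top _

theorem logPotential_eq_coe {μ : Measure (UnitSphere d)} [IsFiniteMeasure μ]
    {x : UnitSphere d} (h : pot μ x ≠ ⊤) :
    logPotential μ x = (((pot μ x).toReal - Real.log 2 * μ.real Set.univ : ℝ) : EReal) := by
  rw [logPotential_eq, ← EReal.coe_ennreal_toReal h, ← EReal.coe_sub]

/-- Adding `log 2` to the kernel adds `log 2` times the total charge to the potential, which only
changes the constant. -/
theorem isSignedLogEquilibrium_iff (θ : SignedMeasure (UnitSphere d)) :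
    IsSignedLogEquilibrium a q θ ↔
      θ.toJordanDecomposition.posPart.real Set.univ -
        θ.toJordanDecomposition.negPart.real Set.univ = 1 ∧
      ∃ G : ℝ, ∀ x, pot θ.toJordanDecomposition.posPart x ≠ ⊤ ∧
        pot θ.toJordanDecomposition.negPart x ≠ ⊤ ∧
        (pot θ.toJordanDecomposition.posPart x).toReal -
          (pot θ.toJordanDecomposition.negPart x).toReal +
          logField a q (x : EuclideanSpace ℝ (Fin (d + 1))) = G := by
  rw [IsSignedLogEquilibrium, signedMeasure_apply_eq_sub θ MeasurableSet.univ]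
  set P := θ.toJordanDecomposition.posPart
  set N := θ.toJordanDecomposition.negPart
  simp only [logPotential_ne_top_iff]
  have key : ∀ (G : ℝ) (x : UnitSphere d), pot P x ≠ ⊤ → pot N x ≠ ⊤ →
      (logPotential P x - logPotential N x +
        ((logField a q (x : EuclideanSpace ℝ (Fin (d + 1))) : ℝ) : EReal) = (G : EReal) ↔
      (pot P x).toReal - (pot N x).toReal + logField a q (x : EuclideanSpace ℝ (Fin (d + 1))) =
        G + Real.log 2 * (P.real Set.univ - N.real Set.univ)) := by
    intro G x hP hN
    rw [logPotential_eq_coe hP, logPotential_eq_coe hN, ← EReal.coe_sub, ← EReal.coe_add,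
      EReal.coe_eq_coe_iff]
    constructor <;> intro h <;> linarith
  refine and_congr_right fun hm => ⟨?_, ?_⟩
  · rintro ⟨G, hG⟩
    exact ⟨_, fun x => ⟨(hG x).1, (hG x).2.1, (key G x (hG x).1 (hG x).2.1).1 (hG x).2.2⟩⟩
  · rintro ⟨G, hG⟩
    refine ⟨G - Real.log 2 * (P.real Set.univ - N.real Set.univ), fun x =>
      ⟨(hG x).1, (hG x).2.1, (key _ x (hG x).1 (hG x).2.1).2 ?_⟩⟩
    rw [(hG x).2.2]
    ring

theorem isSignedLogEquilibrium_sub {p n : Measure (UnitSphere d)} [IsFiniteMeasure p]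
    [IsFiniteMeasure n] (hm : p.real Set.univ - n.real Set.univ = 1) {G : ℝ}
    (hp : ∀ x, pot p x ≠ ⊤) (hn : ∀ x, pot n x ≠ ⊤)
    (h : ∀ x : UnitSphere d, (pot p x).toReal - (pot n x).toReal +
      logField a q (x : EuclideanSpace ℝ (Fin (d + 1))) = G) :
    IsSignedLogEquilibrium a q (p.toSignedMeasure - n.toSignedMeasure) := by
  rw [isSignedLogEquilibrium_iff]
  have hle := posPart_le p n
  have hadd := posPart_add_eq_add_negPart p n
  set P := (p.toSignedMeasure - n.toSignedMeasure).toJordanDecomposition.posPart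
  set N := (p.toSignedMeasure - n.toSignedMeasure).toJordanDecomposition.negPart
  have hP : ∀ x, pot P x ≠ ⊤ := fun x => ((pot_mono hle x).trans_lt (hp x).lt_top).ne
  have hpot : ∀ x, pot P x + pot n x = pot p x + pot N x := fun x => by
    rw [← pot_add, ← pot_add, hadd]
  have hN : ∀ x, pot N x ≠ ⊤ := fun x hx => by
    have := hpot x
    rw [hx, add_top] at this
    exact ENNReal.add_ne_top.2 ⟨hP x, hn x⟩ this
  refine ⟨?_, G, fun x => ⟨hP x, hN x, ?_⟩⟩
  · have : (P + n).real Set.univ = (p + N).real Set.univ := by rw [hadd]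
    rw [measureReal_add_apply, measureReal_add_apply] at this
    linarith
  · have h1 := congrArg ENNReal.toReal (hpot x)
    rw [ENNReal.toReal_add (hP x) (hn x), ENNReal.toReal_add (hp x) (hN x)] at h1
    linarith [h x]

theorem continuous_logField (ha : ‖a‖ ≠ 1) : Continuous fun x : UnitSphere d =>
    logField a q (x : EuclideanSpace ℝ (Fin (d + 1))) :=
  continuous_const.mul (continuous_log_norm_sub ha)

theorem isSignedLogEquilibrium_unique (hd : 1 ≤ d) (ha : ‖a‖ ≠ 1)
    {θ θ' : SignedMeasure (UnitSphere d)} (h : IsSignedLogEquilibrium a q θ)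
    (h' : IsSignedLogEquilibrium a q θ') : θ = θ' := by
  rw [isSignedLogEquilibrium_iff] at h h'
  obtain ⟨hm, G, hG⟩ := h
  obtain ⟨hm', G', hG'⟩ := h'
  have hadd := add_eq_add_of_ae_const hd (continuous_logField ha) hm hm'
    (ae_of_all _ fun x => (hG x).2.2) (ae_of_all _ fun x => (hG' x).2.2)
  ext A hA
  rw [signedMeasure_apply_eq_sub θ hA, signedMeasure_apply_eq_sub θ' hA]
  have := congrArg (fun μ : Measure (UnitSphere d) => μ.real A) hadd
  rw [measureReal_add_apply, measureReal_add_apply] at this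
  linarith

/-! ### Minimizers: existence, uniqueness and variational conditions -/

/-- The weighted energy of a measure for the kernel `log (2 / |x - y|)`, if it is finite. -/
noncomputable def weightedEnergy (Q : UnitSphere d → ℝ) (μ : Measure (UnitSphere d)) : ℝ :=
  (mutEnergy μ μ).toReal + 2 * ∫ x, Q x ∂μ

theorem mutEnergy_unif_ne_top (hd : 1 ≤ d) : mutEnergy (unif d) (unif d) ≠ ⊤ := by
  obtain ⟨C, hC⟩ := mutEnergy_poissonMeasure hd (b := (0 : EuclideanSpace ℝ (Fin (d + 1))))
    (by simp)
  rw [poissonMeasure_zero] at hC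
  exact (hC (unif d)).1

theorem weightedLogEnergy_eq_top {μ : ProbabilityMeasure (UnitSphere d)}
    (h : mutEnergy (μ : Measure (UnitSphere d)) μ = ⊤) : weightedLogEnergy a q μ = ⊤ := by
  rw [weightedLogEnergy, logEnergy_eq, h, EReal.coe_ennreal_top, EReal.top_sub_coe,
    EReal.top_add_coe]

theorem weightedLogEnergy_eq_coe {μ : ProbabilityMeasure (UnitSphere d)}
    (h : mutEnergy (μ : Measure (UnitSphere d)) μ ≠ ⊤) : weightedLogEnergy a q μ =
      ((weightedEnergy (fun x : UnitSphere d => logField a q x.1) μ - Real.log 2 : ℝ) : EReal) := by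
  rw [weightedLogEnergy, logEnergy_eq, ← EReal.coe_ennreal_toReal h, ← EReal.coe_sub,
    ← EReal.coe_add, weightedEnergy]
  congr 1
  ring

/-- The uniform measure has finite energy, so an extremal measure has finite energy too and
real-valued energies suffice. -/
theorem isLogExtremal_iff (hd : 1 ≤ d) (μ : ProbabilityMeasure (UnitSphere d)) :
    IsLogExtremal a q μ ↔ mutEnergy (μ : Measure (UnitSphere d)) μ ≠ ⊤ ∧
      ∀ ν : ProbabilityMeasure (UnitSphere d), mutEnergy (ν : Measure (UnitSphere d)) ν ≠ ⊤ →
        weightedEnergy (fun x : UnitSphere d => logField a q x.1) μ ≤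
          weightedEnergy (fun x : UnitSphere d => logField a q x.1) ν := by
  have hiff : IsLogExtremal a q μ ↔ ∀ ν, weightedLogEnergy a q μ ≤ weightedLogEnergy a q ν :=
    ⟨fun h ν => (le_of_eq h).trans (iInf_le _ ν), fun h => le_antisymm (le_iInf h) (iInf_le _ μ)⟩
  rw [hiff]
  constructor
  · intro h
    have hμ : mutEnergy (μ : Measure (UnitSphere d)) μ ≠ ⊤ := fun hμ => by
      have h1 := h ⟨unif d, inferInstance⟩
      rw [weightedLogEnergy_eq_top hμ, weightedLogEnergy_eq_coe
        (μ := ⟨unif d, inferInstance⟩) (mutEnergy_unif_ne_top hd),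
        top_le_iff] at h1
      exact EReal.coe_ne_top _ h1
    refine ⟨hμ, fun ν hν => ?_⟩
    have h1 := h ν
    rw [weightedLogEnergy_eq_coe hμ, weightedLogEnergy_eq_coe hν, EReal.coe_le_coe_iff] at h1
    linarith
  · rintro ⟨hμ, h⟩ ν
    by_cases hν : mutEnergy (ν : Measure (UnitSphere d)) ν = ⊤
    · rw [weightedLogEnergy_eq_top hν]
      exact le_top
    · rw [weightedLogEnergy_eq_coe hμ, weightedLogEnergy_eq_coe hν, EReal.coe_le_coe_iff]
      linarith [h ν hν]

/-- `μ` has finite energy and minimizes the weighted energy among such probability measures. -/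
def IsMinimizer (Q : UnitSphere d → ℝ) (μ : ProbabilityMeasure (UnitSphere d)) : Prop :=
  mutEnergy (μ : Measure (UnitSphere d)) μ ≠ ⊤ ∧
    ∀ ν : ProbabilityMeasure (UnitSphere d), mutEnergy (ν : Measure (UnitSphere d)) ν ≠ ⊤ →
      weightedEnergy Q μ ≤ weightedEnergy Q ν

variable {Q : UnitSphere d → ℝ}

theorem exists_isMinimizer (hd : 1 ≤ d) (hQ : Continuous Q) :
    ∃ μ : ProbabilityMeasure (UnitSphere d), IsMinimizer Q μ := by
  obtain ⟨M, hM⟩ := (isCompact_range hQ).bddBelow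
  have hnn : ∀ μ : ProbabilityMeasure (UnitSphere d),
      0 ≤ 2 * (∫ x, Q x ∂(μ : Measure (UnitSphere d)) - M) := fun μ => by
    have : ∫ _, M ∂(μ : Measure (UnitSphere d)) ≤ ∫ x, Q x ∂(μ : Measure (UnitSphere d)) :=
      integral_mono (integrable_const _) (hQ.integrable_of_compactSpace _) fun x => hM ⟨x, rfl⟩
    simp only [integral_const, probReal_univ, one_smul] at this
    linarith
  have hcont : Continuous fun μ : ProbabilityMeasure (UnitSphere d) =>
      ∫ x, Q x ∂(μ : Measure (UnitSphere d)) :=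
    ProbabilityMeasure.continuous_integral_boundedContinuousFunction
      (BoundedContinuousFunction.mkOfCompact ⟨Q, hQ⟩)
  -- Subtracting the lower bound `M` of the field makes the functional `ℝ≥0∞`-valued, so that lower
  -- semicontinuity and weak compactness of the probability measures apply directly.
  have hlsc : LowerSemicontinuous fun μ : ProbabilityMeasure (UnitSphere d) =>
      mutEnergy (μ : Measure (UnitSphere d)) μ +
        ENNReal.ofReal (2 * (∫ x, Q x ∂(μ : Measure (UnitSphere d)) - M)) :=
    lowerSemicontinuous_mutEnergy.add (ENNReal.continuous_ofReal.comp
      (continuous_const.mul (hcont.sub continuous_const))).lowerSemicontinuous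
  have : Nonempty (ProbabilityMeasure (UnitSphere d)) := ⟨⟨unif d, inferInstance⟩⟩
  obtain ⟨μ, -, hμ⟩ := (hlsc.lowerSemicontinuousOn Set.univ).exists_isMinOn Set.univ_nonempty
    isCompact_univ
  have hle := fun ν : ProbabilityMeasure (UnitSphere d) => hμ (Set.mem_univ ν)
  simp only [Set.mem_ofPred_eq] at hle
  have hfin : mutEnergy (μ : Measure (UnitSphere d)) μ ≠ ⊤ := by
    refine (le_self_add.trans_lt ((hle ⟨unif d, inferInstance⟩).trans_lt ?_)).ne
    exact ENNReal.add_lt_top.2 ⟨(mutEnergy_unif_ne_top hd).lt_top, ENNReal.ofReal_lt_top⟩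
  refine ⟨μ, hfin, fun ν hν => ?_⟩
  have h := ENNReal.toReal_mono (ENNReal.add_ne_top.2 ⟨hν, ENNReal.ofReal_ne_top⟩) (hle ν)
  rw [ENNReal.toReal_add hfin ENNReal.ofReal_ne_top, ENNReal.toReal_add hν ENNReal.ofReal_ne_top,
    ENNReal.toReal_ofReal (hnn μ), ENNReal.toReal_ofReal (hnn ν)] at h
  unfold weightedEnergy
  linarith

theorem mutEnergy_ne_top {μ ν : Measure (UnitSphere d)} [IsFiniteMeasure μ] [IsFiniteMeasure ν]
    (hμ : mutEnergy μ μ ≠ ⊤) (hν : mutEnergy ν ν ≠ ⊤) : mutEnergy μ ν ≠ ⊤ := by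
  have h := (two_mul_mutEnergy_le μ ν).trans_lt (ENNReal.add_lt_top.2 ⟨hμ.lt_top, hν.lt_top⟩)
  intro h'
  rw [h', ENNReal.mul_top two_ne_zero] at h
  exact lt_irrefl _ h

theorem weightedEnergy_mix (hQ : Continuous Q) {μ ν : ProbabilityMeasure (UnitSphere d)}
    (hμ : mutEnergy (μ : Measure (UnitSphere d)) μ ≠ ⊤)
    (hν : mutEnergy (ν : Measure (UnitSphere d)) ν ≠ ⊤) {t : ℝ} (ht : 0 ≤ t) (ht1 : t ≤ 1) :
    ∃ ρ : ProbabilityMeasure (UnitSphere d), mutEnergy (ρ : Measure (UnitSphere d)) ρ ≠ ⊤ ∧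
      weightedEnergy Q ρ = (1 - t) ^ 2 * (mutEnergy (μ : Measure (UnitSphere d)) μ).toReal +
        2 * t * (1 - t) * (mutEnergy (μ : Measure (UnitSphere d)) ν).toReal +
        t ^ 2 * (mutEnergy (ν : Measure (UnitSphere d)) ν).toReal +
        2 * ((1 - t) * ∫ x, Q x ∂(μ : Measure (UnitSphere d)) +
          t * ∫ x, Q x ∂(ν : Measure (UnitSphere d))) := by
  have h1t : 0 ≤ 1 - t := by linarith
  set u := ENNReal.ofReal (1 - t) with hu
  set v := ENNReal.ofReal t with hv
  have hur : u.toReal = 1 - t := ENNReal.toReal_ofReal h1t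
  have hvr : v.toReal = t := ENNReal.toReal_ofReal ht
  let ρ : Measure (UnitSphere d) := u • (μ : Measure (UnitSphere d)) + v • (ν : Measure _)
  have hρ : IsProbabilityMeasure ρ := ⟨by
    simp only [ρ, Measure.add_apply, Measure.smul_apply, measure_univ, smul_eq_mul, mul_one]
    rw [hu, hv, ← ENNReal.ofReal_add h1t ht]
    simp⟩
  have hμν := mutEnergy_ne_top hμ hν
  have hE : mutEnergy ρ ρ = u * (u * mutEnergy (μ : Measure (UnitSphere d)) μ +
      v * mutEnergy (μ : Measure (UnitSphere d)) ν) +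
      v * (u * mutEnergy (μ : Measure (UnitSphere d)) ν +
      v * mutEnergy (ν : Measure (UnitSphere d)) ν) := by
    have : ∀ (κ : Measure (UnitSphere d)) [IsFiniteMeasure κ], mutEnergy κ ρ =
        u * mutEnergy (μ : Measure (UnitSphere d)) κ +
          v * mutEnergy (ν : Measure (UnitSphere d)) κ := fun κ _ => by
      rw [mutEnergy_comm, mutEnergy_add_left, mutEnergy_smul_left, mutEnergy_smul_left]
    rw [mutEnergy_add_left, mutEnergy_smul_left, mutEnergy_smul_left, this, this,
      mutEnergy_comm (ν : Measure (UnitSphere d)) μ]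
  have hu' : u ≠ ⊤ := ENNReal.ofReal_ne_top
  have hv' : v ≠ ⊤ := ENNReal.ofReal_ne_top
  refine ⟨⟨ρ, hρ⟩, ?_, ?_⟩
  · change mutEnergy ρ ρ ≠ ⊤
    rw [hE]
    finiteness
  · change (mutEnergy ρ ρ).toReal + 2 * ∫ x, Q x ∂ρ = _
    rw [hE, ENNReal.toReal_add (by finiteness) (by finiteness), ENNReal.toReal_mul,
      ENNReal.toReal_mul, ENNReal.toReal_add (by finiteness) (by finiteness),
      ENNReal.toReal_add (by finiteness) (by finiteness), ENNReal.toReal_mul, ENNReal.toReal_mul,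
      ENNReal.toReal_mul, ENNReal.toReal_mul, hur, hvr,
      integral_add_measure ((hQ.integrable_of_compactSpace _).smul_measure hu')
        ((hQ.integrable_of_compactSpace _).smul_measure hv'),
      integral_smul_measure, integral_smul_measure, hur, hvr, smul_eq_mul, smul_eq_mul]
    ring

theorem IsMinimizer.variation (hQ : Continuous Q) {μ ν : ProbabilityMeasure (UnitSphere d)}
    (hμ : IsMinimizer Q μ) (hν : mutEnergy (ν : Measure (UnitSphere d)) ν ≠ ⊤) :
    (mutEnergy (μ : Measure (UnitSphere d)) μ).toReal + ∫ x, Q x ∂(μ : Measure (UnitSphere d)) ≤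
      (mutEnergy (μ : Measure (UnitSphere d)) ν).toReal +
        ∫ x, Q x ∂(ν : Measure (UnitSphere d)) := by
  set A := (mutEnergy (μ : Measure (UnitSphere d)) μ).toReal with hA
  set B := (mutEnergy (μ : Measure (UnitSphere d)) ν).toReal
  set C := (mutEnergy (ν : Measure (UnitSphere d)) ν).toReal
  set U := ∫ x, Q x ∂(μ : Measure (UnitSphere d)) with hU
  set V := ∫ x, Q x ∂(ν : Measure (UnitSphere d))
  -- The right side is the increase of the weighted energy from `μ` to `(1 - t) μ + t ν`, divided by
  -- `t`.
  have key : ∀ t : ℝ, 0 < t → t ≤ 1 → 0 ≤ 2 * (B + V - A - U) + t * (A - 2 * B + C) := by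
    intro t ht ht1
    obtain ⟨ρ, hρ, hE⟩ := weightedEnergy_mix hQ hμ.1 hν ht.le ht1
    have h := hμ.2 ρ hρ
    rw [hE, weightedEnergy, ← hA, ← hU] at h
    refine nonneg_of_mul_nonneg_right (a := t) ?_ ht
    linarith
  have hlim : Tendsto (fun t : ℝ => 2 * (B + V - A - U) + t * (A - 2 * B + C)) (𝓝[>] 0)
      (𝓝 (2 * (B + V - A - U) + 0 * (A - 2 * B + C))) :=
    ((by fun_prop : Continuous fun t : ℝ =>
      2 * (B + V - A - U) + t * (A - 2 * B + C)).tendsto 0).mono_left nhdsWithin_le_nhds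
  have := ge_of_tendsto hlim (by
    filter_upwards [Ioo_mem_nhdsGT (zero_lt_one' ℝ)] with t ht using key t ht.1 ht.2.le)
  linarith

theorem IsMinimizer.unique (hQ : Continuous Q) {μ ν : ProbabilityMeasure (UnitSphere d)}
    (hμ : IsMinimizer Q μ) (hν : IsMinimizer Q ν) : μ = ν := by
  have h1 := hμ.variation hQ hν.1
  have h2 := hν.variation hQ hμ.1
  have hμν := mutEnergy_ne_top hμ.1 hν.1
  rw [mutEnergy_comm (ν : Measure (UnitSphere d)) μ] at h2
  suffices h : (μ : Measure (UnitSphere d)) = ν from Subtype.ext h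
  -- Adding the two variational inequalities cancels the field and leaves equality in the
  -- positive-definiteness bound.
  refine eq_of_mutEnergy_add_le hμ.1 hν.1 ?_
  have hμ1 := hμ.1
  have hν1 := hν.1
  rw [← ENNReal.toReal_le_toReal (by finiteness) (by finiteness), ENNReal.toReal_add hμ1 hν1,
    ENNReal.toReal_mul, ENNReal.toReal_ofNat]
  linarith

theorem integrable_toReal_pot {μ ν : Measure (UnitSphere d)} [IsFiniteMeasure μ]
    [IsFiniteMeasure ν] (h : mutEnergy μ ν ≠ ⊤) :
    Integrable (fun x => (pot μ x).toReal) ν ∧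
      ∫ x, (pot μ x).toReal ∂ν = (mutEnergy μ ν).toReal := by
  rw [mutEnergy_comm] at h ⊢
  exact ⟨integrable_toReal_of_lintegral_ne_top (measurable_pot μ).aemeasurable h,
    integral_toReal (measurable_pot μ).aemeasurable (ae_lt_top (measurable_pot μ) h)⟩

/-- The weighted potential of a minimizer is bounded below, up to sets of zero capacity. -/
theorem IsMinimizer.ae_le (hQ : Continuous Q) {μ : ProbabilityMeasure (UnitSphere d)}
    (hμ : IsMinimizer Q μ) {ν : Measure (UnitSphere d)} [IsFiniteMeasure ν]
    (hν : mutEnergy ν ν ≠ ⊤) : ∀ᵐ x ∂ν,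
      (mutEnergy (μ : Measure (UnitSphere d)) μ).toReal + ∫ x, Q x ∂(μ : Measure (UnitSphere d)) ≤
        (pot μ x).toReal + Q x := by
  set F := (mutEnergy (μ : Measure (UnitSphere d)) μ).toReal +
    ∫ x, Q x ∂(μ : Measure (UnitSphere d))
  let B : Set (UnitSphere d) := {x | (pot μ x).toReal + Q x < F}
  have hB : MeasurableSet B := measurableSet_lt
    ((measurable_pot (μ : Measure (UnitSphere d))).ennreal_toReal.add hQ.measurable)
    measurable_const
  suffices hB0 : ν B = 0 by
    rw [ae_iff]
    simpa only [not_le] using hB0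
  by_contra hB0
  have hprob : IsProbabilityMeasure ((ν B)⁻¹ • ν.restrict B) := ⟨by
    rw [Measure.smul_apply, Measure.restrict_apply_univ, smul_eq_mul,
      ENNReal.inv_mul_cancel hB0 (measure_ne_top _ _)]⟩
  -- The normalized restriction to the bad set is an admissible competitor that would violate the
  -- variational inequality.
  let κ : ProbabilityMeasure (UnitSphere d) := ⟨(ν B)⁻¹ • ν.restrict B, hprob⟩
  have hκ : mutEnergy (κ : Measure (UnitSphere d)) κ ≠ ⊤ := by
    change mutEnergy ((ν B)⁻¹ • ν.restrict B) ((ν B)⁻¹ • ν.restrict B) ≠ ⊤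
    rw [mutEnergy_smul_left, mutEnergy_comm, mutEnergy_smul_left]
    have h1 : mutEnergy (ν.restrict B) (ν.restrict B) ≠ ⊤ :=
      ((mutEnergy_mono Measure.restrict_le_self Measure.restrict_le_self).trans_lt hν.lt_top).ne
    have h2 : (ν B)⁻¹ ≠ ⊤ := ENNReal.inv_ne_top.2 hB0
    finiteness
  have hvar := hμ.variation hQ hκ
  obtain ⟨hi, hie⟩ := integrable_toReal_pot (mutEnergy_ne_top hμ.1 hκ)
  have hQi := hQ.integrable_of_compactSpace (κ : Measure (UnitSphere d))
  have hsum : Integrable (fun x => (pot μ x).toReal + Q x) (κ : Measure (UnitSphere d)) :=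
    hi.add hQi
  have hf : Integrable (fun x => F - ((pot μ x).toReal + Q x)) (κ : Measure (UnitSphere d)) :=
    (integrable_const F).sub hsum
  have hlt : ∀ᵐ x ∂(κ : Measure (UnitSphere d)), (pot μ x).toReal + Q x < F :=
    Measure.smul_absolutelyContinuous.ae_le (ae_restrict_mem hB)
  have hle : ∫ x, (F - ((pot μ x).toReal + Q x)) ∂(κ : Measure (UnitSphere d)) ≤ 0 := by
    rw [integral_sub (integrable_const F) hsum, integral_add hi hQi, hie, integral_const,
      probReal_univ, one_smul]
    linarith
  have hnn : 0 ≤ᵐ[(κ : Measure (UnitSphere d))] fun x => F - ((pot μ x).toReal + Q x) :=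
    hlt.mono fun x hx => (sub_pos.2 hx).le
  have hz := (integral_eq_zero_iff_of_nonneg_ae hnn hf).1
    (le_antisymm hle (integral_nonneg_of_ae hnn))
  have : ∀ᵐ x ∂(κ : Measure (UnitSphere d)), False := by
    filter_upwards [hz, hlt] with x h1 h2
    simp only [Pi.zero_apply] at h1
    linarith
  rw [eventually_false_iff_eq_bot, ae_eq_bot] at this
  exact IsProbabilityMeasure.ne_zero (κ : Measure (UnitSphere d)) this

/-- The weighted potential of a minimizer with full support is constant almost everywhere. -/
theorem IsMinimizer.ae_const (hd : 1 ≤ d) (hQ : Continuous Q)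
    {μ : ProbabilityMeasure (UnitSphere d)} (hμ : IsMinimizer Q μ)
    (hs : (μ : Measure (UnitSphere d)).support = Set.univ) :
    ∃ G : ℝ, ∀ᵐ x ∂unif d, (pot μ x).toReal + Q x = G := by
  have hσ := hμ.ae_le hQ (mutEnergy_unif_ne_top hd)
  have hμμ := hμ.ae_le hQ hμ.1
  set F := (mutEnergy (μ : Measure (UnitSphere d)) μ).toReal +
    ∫ x, Q x ∂(μ : Measure (UnitSphere d)) with hF
  obtain ⟨hi, hie⟩ := integrable_toReal_pot hμ.1
  have hQi := hQ.integrable_of_compactSpace (μ : Measure (UnitSphere d))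
  have hsum : Integrable (fun x => (pot μ x).toReal + Q x) (μ : Measure (UnitSphere d)) :=
    hi.add hQi
  have hfin : ∀ᵐ x ∂(μ : Measure (UnitSphere d)), pot μ x < ⊤ :=
    ae_lt_top (measurable_pot _) hμ.1
  -- The lower bound `F` is also the `μ`-average of the weighted potential.
  have heq : ∀ᵐ x ∂(μ : Measure (UnitSphere d)), (pot μ x).toReal + Q x = F := by
    have hnn : 0 ≤ᵐ[(μ : Measure (UnitSphere d))] fun x => (pot μ x).toReal + Q x - F :=
      hμμ.mono fun x hx => sub_nonneg.2 hx
    have hz := (integral_eq_zero_iff_of_nonneg_ae hnn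
      (hsum.sub (integrable_const F))).1 (by
        rw [integral_sub hsum (integrable_const F), integral_add hi hQi, hie,
          integral_const, probReal_univ, one_smul, hF, sub_self])
    exact hz.mono fun x hx => sub_eq_zero.1 hx
  -- A closed form of "weighted potential at most `F`". Comparing in `ℝ≥0∞` also forces the
  -- potential to be finite, and `Q x ≤ F` excludes the truncation of `ENNReal.ofReal` at zero. As
  -- `S` is closed of full `μ`-measure, it contains the support.
  let S : Set (UnitSphere d) :=
    {x | pot μ x ≤ ENNReal.ofReal (F - Q x)} ∩ {x | Q x ≤ F}
  have hSc : IsClosed S := by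
    refine IsClosed.inter ?_ (isClosed_le hQ continuous_const)
    exact (lowerSemicontinuous_iff_isClosed_epigraph.1
      (lowerSemicontinuous_pot (μ : Measure (UnitSphere d)))).preimage
      (continuous_id.prodMk (ENNReal.continuous_ofReal.comp (continuous_const.sub hQ)))
  have hSμ : S ∈ ae (μ : Measure (UnitSphere d)) := by
    filter_upwards [heq, hfin] with x h1 h2
    have h3 : F - Q x = (pot μ x).toReal := by linarith
    refine ⟨?_, ?_⟩
    · rw [Set.mem_ofPred_eq, h3, ENNReal.ofReal_toReal h2.ne]
    · have : 0 ≤ (pot μ x).toReal := ENNReal.toReal_nonneg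
      rw [Set.mem_ofPred_eq]
      linarith
  have hSu : ∀ x, x ∈ S := fun x => Measure.support_subset_of_isClosed hSc hSμ (hs ▸ Set.mem_univ x)
  refine ⟨F, hσ.mono fun x hx => le_antisymm ?_ hx⟩
  have h1 := ENNReal.toReal_mono ENNReal.ofReal_ne_top (hSu x).1
  rw [ENNReal.toReal_ofReal (sub_nonneg.2 (hSu x).2)] at h1
  linarith

/-- A probability measure with constant weighted potential is a minimizer. -/
theorem isMinimizer_of_const (hQ : Continuous Q) {π : ProbabilityMeasure (UnitSphere d)} {G : ℝ}
    (hπ : mutEnergy (π : Measure (UnitSphere d)) π ≠ ⊤)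
    (h : ∀ x, (pot π x).toReal + Q x = G) : IsMinimizer Q π := by
  refine ⟨hπ, fun ν hν => ?_⟩
  have key : ∀ κ : ProbabilityMeasure (UnitSphere d),
      mutEnergy (κ : Measure (UnitSphere d)) κ ≠ ⊤ →
      (mutEnergy (π : Measure (UnitSphere d)) κ).toReal =
        G - ∫ x, Q x ∂(κ : Measure (UnitSphere d)) := by
    intro κ hκ
    obtain ⟨-, hie⟩ := integrable_toReal_pot (mutEnergy_ne_top hπ hκ)
    have hp : ∀ x, (pot π x).toReal = G - Q x := fun x => by linarith [h x]
    rw [← hie]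
    simp only [hp]
    rw [integral_sub (integrable_const _) (hQ.integrable_of_compactSpace _), integral_const,
      probReal_univ, one_smul]
  have h1 := key π hπ
  have h2 := key ν hν
  have hm := mutEnergy_ne_top hπ hν
  -- The mutual energy with `π` is affine in the integral of the field, so positive definiteness
  -- alone compares the two weighted energies.
  have h3 := ENNReal.toReal_mono (ENNReal.add_ne_top.2 ⟨hπ, hν⟩)
    (two_mul_mutEnergy_le (π : Measure (UnitSphere d)) ν)
  rw [ENNReal.toReal_add hπ hν, ENNReal.toReal_mul, ENNReal.toReal_ofNat] at h3
  unfold weightedEnergy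
  linarith

end UnitSphere

/-! ### The explicit density of the signed equilibrium and its sign -/

namespace UnitSphere

variable {d : ℕ} {a : EuclideanSpace ℝ (Fin (d + 1))} {q : ℝ}

theorem withDensity_le_smul_unif {g : UnitSphere d → ℝ} (hg : Continuous g) :
    ∃ K : ℝ≥0∞, K ≠ ⊤ ∧ (unif d).withDensity (fun x => ENNReal.ofReal (g x)) ≤ K • unif d := by
  obtain ⟨M, hM⟩ := (isCompact_range hg).bddAbove
  refine ⟨ENNReal.ofReal M, ENNReal.ofReal_ne_top, ?_⟩
  rw [← withDensity_const]
  exact withDensity_mono (ae_of_all _ fun x => ENNReal.ofReal_le_ofReal (hM ⟨x, rfl⟩))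

theorem isFiniteMeasure_withDensity_unif {g : UnitSphere d → ℝ} (hg : Continuous g) :
    IsFiniteMeasure ((unif d).withDensity fun x => ENNReal.ofReal (g x)) := by
  obtain ⟨K, hK, hle⟩ := withDensity_le_smul_unif hg
  refine ⟨(hle Set.univ).trans_lt ?_⟩
  rw [Measure.smul_apply, measure_univ, smul_eq_mul, mul_one]
  exact hK.lt_top

theorem pot_withDensity_ne_top (hd : 1 ≤ d) {g : UnitSphere d → ℝ} (hg : Continuous g)
    (x : UnitSphere d) : pot ((unif d).withDensity fun x => ENNReal.ofReal (g x)) x ≠ ⊤ := by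
  obtain ⟨K, hK, hle⟩ := withDensity_le_smul_unif hg
  refine ((pot_mono hle x).trans_lt ?_).ne
  rw [pot_smul]
  exact ENNReal.mul_lt_top hK.lt_top (pot_unif_ne_top hd x).lt_top

theorem integrable_mul_logKer (hd : 1 ≤ d) {g : UnitSphere d → ℝ} (hg : Continuous g)
    (x : UnitSphere d) : Integrable (fun y => g y * (logKer x y).toReal) (unif d) := by
  obtain ⟨M, hM⟩ := (isCompact_range hg.norm).bddAbove
  exact (integrable_toReal_of_lintegral_ne_top (measurable_logKer_left x).aemeasurable
    (pot_unif_ne_top hd x)).bdd_mul hg.aestronglyMeasurable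
    (ae_of_all _ fun y => hM ⟨y, rfl⟩)

theorem pot_withDensity_sub (hd : 1 ≤ d) {g : UnitSphere d → ℝ} (hg : Continuous g)
    (x : UnitSphere d) :
    (pot ((unif d).withDensity fun x => ENNReal.ofReal (g x)) x).toReal -
      (pot ((unif d).withDensity fun x => ENNReal.ofReal (-g x)) x).toReal =
      ∫ y, g y * (logKer x y).toReal ∂unif d := by
  have key : ∀ f : UnitSphere d → ℝ, Continuous f →
      pot ((unif d).withDensity fun x => ENNReal.ofReal (f x)) x =
        ∫⁻ y, ENNReal.ofReal (f y * (logKer x y).toReal) ∂unif d := by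
    intro f hf
    rw [pot, lintegral_withDensity_eq_lintegral_mul _ hf.measurable.ennreal_ofReal
      (measurable_logKer_left x)]
    refine lintegral_congr_ae ?_
    filter_upwards [ae_lt_top (measurable_logKer_left x) (pot_unif_ne_top hd x)] with y hy
    rw [Pi.mul_apply, ENNReal.ofReal_mul' ENNReal.toReal_nonneg, ENNReal.ofReal_toReal hy.ne]
  rw [integral_eq_lintegral_pos_part_sub_lintegral_neg_part (integrable_mul_logKer hd hg x),
    key g hg, key (fun y => -g y) hg.neg]
  simp only [neg_mul]

theorem withDensity_univ_sub {g : UnitSphere d → ℝ} (hg : Continuous g) :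
    ((unif d).withDensity fun x => ENNReal.ofReal (g x)).real Set.univ -
      ((unif d).withDensity fun x => ENNReal.ofReal (-g x)).real Set.univ =
      ∫ y, g y ∂unif d := by
  rw [integral_eq_lintegral_pos_part_sub_lintegral_neg_part (hg.integrable_of_compactSpace _),
    measureReal_def, measureReal_def, withDensity_apply _ MeasurableSet.univ,
    withDensity_apply _ MeasurableSet.univ, Measure.restrict_univ]

/-- The density of the signed equilibrium with respect to the uniform measure. -/
noncomputable def eqDensity (a : EuclideanSpace ℝ (Fin (d + 1))) (q : ℝ) (x : UnitSphere d) : ℝ :=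
  1 + q - q * poissonFactor a x ^ d

/-- The positive part of the signed equilibrium. -/
noncomputable def eqPos (a : EuclideanSpace ℝ (Fin (d + 1))) (q : ℝ) : Measure (UnitSphere d) :=
  (unif d).withDensity fun x => ENNReal.ofReal (eqDensity a q x)

/-- The negative part of the signed equilibrium. -/
noncomputable def eqNeg (a : EuclideanSpace ℝ (Fin (d + 1))) (q : ℝ) : Measure (UnitSphere d) :=
  (unif d).withDensity fun x => ENNReal.ofReal (-eqDensity a q x)

theorem continuous_poissonFactor_pow (ha : ‖a‖ ≠ 1) :
    Continuous fun x : UnitSphere d => poissonFactor a x ^ d :=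
  (continuous_poissonFactor ha).pow d

theorem continuous_eqDensity (ha : ‖a‖ ≠ 1) : Continuous (eqDensity a q) :=
  continuous_const.sub (continuous_const.mul (continuous_poissonFactor_pow ha))

theorem integral_poissonFactor_pow (ha : ‖a‖ ≠ 1) :
    ∫ x, poissonFactor a x ^ d ∂unif d = 1 := by
  have := isProbabilityMeasure_poissonMeasure (d := d) ha
  have h : poissonMeasure a (Set.univ : Set (UnitSphere d)) = 1 := measure_univ
  rw [poissonMeasure, withDensity_apply _ MeasurableSet.univ, Measure.restrict_univ] at h
  rw [integral_eq_lintegral_of_nonneg_ae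
    (ae_of_all _ fun x => (pow_pos (poissonFactor_pos ha x) d).le)
    (continuous_poissonFactor_pow ha).aestronglyMeasurable, h,
    ENNReal.toReal_one]

theorem eqPos_sub_eqNeg_univ (ha : ‖a‖ ≠ 1) :
    (eqPos a q).real Set.univ - (eqNeg a q).real Set.univ = 1 := by
  rw [eqPos, eqNeg, withDensity_univ_sub (continuous_eqDensity ha)]
  unfold eqDensity
  rw [integral_sub (integrable_const _) (((continuous_poissonFactor_pow
    ha).integrable_of_compactSpace _).const_mul q), integral_const_mul,
    integral_poissonFactor_pow ha, integral_const, probReal_univ, one_smul]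
  ring

/-- The part `-q * poissonFactor a ^ d` of the density has potential `q log ‖x - a‖` up to a
constant, which cancels the field; the uniform part `1 + q` restores mass one and has constant
potential. -/
theorem exists_pot_eqPos_sub (hd : 1 ≤ d) (ha : ‖a‖ ≠ 1) : ∃ G : ℝ, ∀ x : UnitSphere d,
    (pot (eqPos a q) x).toReal - (pot (eqNeg a q) x).toReal +
      logField a q (x : EuclideanSpace ℝ (Fin (d + 1))) = G := by
  obtain ⟨C, hC⟩ := toReal_pot_poissonMeasure hd ha
  obtain ⟨C₀, hC₀⟩ := toReal_pot_poissonMeasure hd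
    (b := (0 : EuclideanSpace ℝ (Fin (d + 1)))) (by simp)
  have hpos : ∀ (b : EuclideanSpace ℝ (Fin (d + 1))), ‖b‖ ≠ 1 → ∀ x : UnitSphere d,
      ∫ y, poissonFactor b y ^ d * (logKer x y).toReal ∂unif d =
        (pot (poissonMeasure b) x).toReal := by
    intro b hb x
    have h := pot_withDensity_sub hd (continuous_poissonFactor_pow (d := d) hb) x
    have h0 : (unif d).withDensity (fun y => ENNReal.ofReal (-(poissonFactor b y ^ d))) = 0 := by
      rw [withDensity_eq_zero_iff]
      · exact ae_of_all _ fun y => ENNReal.ofReal_of_nonpos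
          (neg_nonpos.2 (pow_pos (poissonFactor_pos hb y) d).le)
      · exact (continuous_poissonFactor_pow hb).neg.measurable.ennreal_ofReal.aemeasurable
    rw [h0] at h
    rw [← h]
    simp [pot, poissonMeasure]
  refine ⟨(1 + q) * C₀ - q * C, fun x => ?_⟩
  have h1 := integrable_mul_logKer hd (continuous_const (y := (1 : ℝ))) x
  have h2 := integrable_mul_logKer hd (continuous_poissonFactor_pow ha) x
  have h3 : ∀ y, eqDensity a q y * (logKer x y).toReal = (1 + q) * (logKer x y).toReal -
      q * (poissonFactor a y ^ d * (logKer x y).toReal) := fun y => by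
    rw [eqDensity]; ring
  have h4 := hpos 0 (by simp) x
  simp only [poissonFactor_zero, one_pow, one_mul] at h4 h1
  rw [eqPos, eqNeg, pot_withDensity_sub hd (continuous_eqDensity ha), integral_congr_ae
    (ae_of_all _ h3), integral_sub (h1.const_mul _) (h2.const_mul _), integral_const_mul,
    integral_const_mul, h4, hpos a ha x, hC, hC₀, logField]
  simp only [sub_zero, norm_coe, Real.log_one]
  ring

/-- The values of the conformal factor. -/
theorem exists_poissonFactor_extrema (ha : ‖a‖ ≠ 1) : ∃ e e' : UnitSphere d,
    poissonFactor a e = (‖a‖ + 1) / |‖a‖ - 1| ∧ poissonFactor a e' = |‖a‖ - 1| / (‖a‖ + 1) ∧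
    ∀ x : UnitSphere d, poissonFactor a x ≤ poissonFactor a e ∧
      poissonFactor a e' ≤ poissonFactor a x ∧
      (a ≠ 0 → poissonFactor a e ≤ poissonFactor a x → x = e) ∧
      (a ≠ 0 → poissonFactor a x ≤ poissonFactor a e' → x = e') := by
  obtain ⟨u, hu, hau⟩ : ∃ u : EuclideanSpace ℝ (Fin (d + 1)), ‖u‖ = 1 ∧ a = ‖a‖ • u := by
    by_cases h : a = 0
    · exact ⟨EuclideanSpace.single 0 1, by simp, by simp [h]⟩
    · exact ⟨‖a‖⁻¹ • a, by simp [norm_smul, h], by simp [h]⟩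
  set R := ‖a‖ with hR
  have hR0 : 0 ≤ R := norm_nonneg a
  have hR1 : R - 1 ≠ 0 := sub_ne_zero.2 ha
  have hnum := abs_one_sub_sq_pos ha
  have habs : |1 - R ^ 2| = |R - 1| * (R + 1) := by
    rw [show 1 - R ^ 2 = -((R - 1) * (R + 1)) by ring, abs_neg, abs_mul,
      abs_of_nonneg (by linarith : 0 ≤ R + 1)]
  have hsq : ∀ x : UnitSphere d, ‖(x : EuclideanSpace ℝ (Fin (d + 1))) - a‖ ^ 2 =
      1 + R ^ 2 - 2 * R * ⟪(x : EuclideanSpace ℝ (Fin (d + 1))), u⟫ := by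
    intro x
    have : ⟪(x : EuclideanSpace ℝ (Fin (d + 1))), a⟫ =
        R * ⟪(x : EuclideanSpace ℝ (Fin (d + 1))), u⟫ := by
      conv_lhs => rw [hau, inner_smul_right]
    rw [norm_sub_sq_real, norm_coe, this, ← hR]
    ring
  have hle : ∀ x y : UnitSphere d, poissonFactor a x ≤ poissonFactor a y ↔
      ‖(y : EuclideanSpace ℝ (Fin (d + 1))) - a‖ ^ 2 ≤
        ‖(x : EuclideanSpace ℝ (Fin (d + 1))) - a‖ ^ 2 := fun x y =>
    div_le_div_iff_of_pos_left hnum (pow_pos (norm_coe_sub_pos ha x) 2)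
      (pow_pos (norm_coe_sub_pos ha y) 2)
  have huu : ⟪u, u⟫ = (1 : ℝ) := by rw [real_inner_self_eq_norm_sq, hu, one_pow]
  let e : UnitSphere d := ⟨u, by rw [mem_sphere_zero_iff_norm, hu]⟩
  let e' : UnitSphere d := ⟨-u, by rw [mem_sphere_zero_iff_norm, norm_neg, hu]⟩
  have he : ‖(e : EuclideanSpace ℝ (Fin (d + 1))) - a‖ ^ 2 = |R - 1| ^ 2 := by
    rw [hsq, huu, sq_abs]; ring
  have he' : ‖(e' : EuclideanSpace ℝ (Fin (d + 1))) - a‖ ^ 2 = (R + 1) ^ 2 := by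
    rw [hsq, show (e' : EuclideanSpace ℝ (Fin (d + 1))) = -u from rfl, inner_neg_left, huu]; ring
  have hR1' : |R - 1| ≠ 0 := abs_ne_zero.2 hR1
  have hR2 : R + 1 ≠ 0 := by positivity
  refine ⟨e, e', ?_, ?_, fun x => ?_⟩
  · rw [poissonFactor, he, ← hR, habs]
    field_simp
  · rw [poissonFactor, he', ← hR, habs]
    field_simp
  · have hx := abs_le.1 ((abs_inner_le x u).trans_eq hu)
    rw [hle, hle, hle, hle, he, he', hsq, sq_abs]
    -- The squared distance to `a` is affine in `⟪x, u⟫` with slope `-2 * R`, so the extrema lie at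
    -- `u` and `-u`. They are unique only when `a ≠ 0`, since otherwise the factor is constant.
    refine ⟨by nlinarith, by nlinarith, fun h0 h => ?_, fun h0 h => ?_⟩
    · have hRpos : 0 < R := norm_pos_iff.2 h0
      have h1 : ⟪(x : EuclideanSpace ℝ (Fin (d + 1))), u⟫ = 1 := by nlinarith
      exact Subtype.ext ((inner_eq_one_iff_of_norm_eq_one (norm_coe x) hu).1 h1)
    · have hRpos : 0 < R := norm_pos_iff.2 h0
      have h1 : ⟪(x : EuclideanSpace ℝ (Fin (d + 1))), -u⟫ = 1 := by
        rw [inner_neg_right]; nlinarith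
      exact Subtype.ext ((inner_eq_one_iff_of_norm_eq_one (norm_coe x) (by rw [norm_neg, hu])).1 h1)

theorem eqDensity_nonneg_iff_of_pos (hq : 0 < q) (x : UnitSphere d) :
    0 ≤ eqDensity a q x ↔ poissonFactor a x ^ d ≤ (1 + q) / q := by
  rw [eqDensity, sub_nonneg, le_div_iff₀ hq, mul_comm]

theorem eqDensity_nonneg_iff_of_neg (hq : q < 0) (x : UnitSphere d) :
    0 ≤ eqDensity a q x ↔ (1 + q) / q ≤ poissonFactor a x ^ d := by
  rw [eqDensity, sub_nonneg, div_le_iff_of_neg hq, mul_comm]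

theorem forall_eqDensity_nonneg_iff_of_pos (ha : ‖a‖ ≠ 1) (hq : 0 < q) :
    (∀ x : UnitSphere d, 0 ≤ eqDensity a q x) ↔
      ((‖a‖ + 1) / |‖a‖ - 1|) ^ d ≤ (1 + q) / q := by
  obtain ⟨e, e', he, he', h⟩ := exists_poissonFactor_extrema (d := d) ha
  simp only [eqDensity_nonneg_iff_of_pos hq]
  rw [← he]
  exact ⟨fun H => H e, fun H x => (pow_le_pow_left₀ (poissonFactor_pos ha x).le (h x).1 d).trans H⟩

theorem forall_eqDensity_nonneg_iff_of_neg (ha : ‖a‖ ≠ 1) (hq : q < 0) :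
    (∀ x : UnitSphere d, 0 ≤ eqDensity a q x) ↔
      (1 + q) / q ≤ (|‖a‖ - 1| / (‖a‖ + 1)) ^ d := by
  obtain ⟨e, e', he, he', h⟩ := exists_poissonFactor_extrema (d := d) ha
  simp only [eqDensity_nonneg_iff_of_neg hq]
  rw [← he']
  exact ⟨fun H => H e', fun H x =>
    H.trans (pow_le_pow_left₀ (poissonFactor_pos ha e').le (h x).2.1 d)⟩

theorem exists_of_eqDensity_eq_zero (hd : 1 ≤ d) (ha : ‖a‖ ≠ 1) (hq : q ≠ 0)
    (h : ∀ x : UnitSphere d, 0 ≤ eqDensity a q x) :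
    ∃ e : UnitSphere d, ∀ x, eqDensity a q x = 0 → x = e := by
  obtain ⟨e, e', -, -, hx⟩ := exists_poissonFactor_extrema (d := d) ha
  have hd0 : d ≠ 0 := by omega
  -- At `a = 0` the density is identically `1`.
  have ha0 : ∀ x : UnitSphere d, eqDensity a q x = 0 → a ≠ 0 := by
    rintro x hx rfl
    simp [eqDensity, poissonFactor_zero] at hx
  have hz : ∀ x : UnitSphere d, eqDensity a q x = 0 → poissonFactor a x ^ d = (1 + q) / q := by
    intro x hx
    rw [eqDensity] at hx
    field_simp
    linarith
  have hp := fun x : UnitSphere d => (poissonFactor_pos ha x).le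
  rcases hq.lt_or_gt with hq | hq
  · refine ⟨e', fun x h0 => (hx x).2.2.2 (ha0 x h0) ?_⟩
    have := (eqDensity_nonneg_iff_of_neg hq e').1 (h e')
    rw [← hz x h0] at this
    exact (pow_le_pow_iff_left₀ (hp x) (hp e') hd0).1 this
  · refine ⟨e, fun x h0 => (hx x).2.2.1 (ha0 x h0) ?_⟩
    have := (eqDensity_nonneg_iff_of_pos hq e).1 (h e)
    rw [← hz x h0] at this
    exact (pow_le_pow_iff_left₀ (hp e) (hp x) hd0).1 this

theorem support_eqPos (hd : 1 ≤ d) (ha : ‖a‖ ≠ 1) (hq : q ≠ 0)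
    (h : ∀ x : UnitSphere d, 0 ≤ eqDensity a q x) : (eqPos a q).support = Set.univ := by
  obtain ⟨e, he⟩ := exists_of_eqDensity_eq_zero hd ha hq h
  have hac : unif d ≪ eqPos a q := by
    refine withDensity_absolutelyContinuous'
      (continuous_eqDensity ha).measurable.ennreal_ofReal.aemeasurable ?_
    -- The only possible zero of the density is a null point, because a finite potential excludes
    -- atoms.
    filter_upwards [ae_ne_of_pot_ne_top (pot_unif_ne_top hd e)] with x hx
    refine (ENNReal.ofReal_pos.2 (lt_of_le_of_ne (h x) fun h0 => hx (he x h0.symm).symm)).ne'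
  rw [Set.eq_univ_iff_forall]
  intro x
  refine hac.support_mono ?_
  rw [Measure.support_eq_univ]
  exact Set.mem_univ x

theorem isLogExtremal_iff_isMinimizer (hd : 1 ≤ d) (μ : ProbabilityMeasure (UnitSphere d)) :
    IsLogExtremal a q μ ↔ IsMinimizer (fun x : UnitSphere d => logField a q x.1) μ :=
  isLogExtremal_iff hd μ

theorem IsMinimizer.add_eqNeg_eq (hd : 1 ≤ d) (ha : ‖a‖ ≠ 1)
    {μ : ProbabilityMeasure (UnitSphere d)}
    (hμ : IsMinimizer (fun x : UnitSphere d => logField a q x.1) μ)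
    (hs : (μ : Measure (UnitSphere d)).support = Set.univ) :
    (μ : Measure (UnitSphere d)) + eqNeg a q = eqPos a q := by
  have : IsFiniteMeasure (eqPos a q) := isFiniteMeasure_withDensity_unif (continuous_eqDensity ha)
  have : IsFiniteMeasure (eqNeg a q) :=
    isFiniteMeasure_withDensity_unif (continuous_eqDensity ha).neg
  obtain ⟨G, hG⟩ := hμ.ae_const hd (continuous_logField ha) hs
  obtain ⟨G', hG'⟩ := exists_pot_eqPos_sub (q := q) hd ha
  rw [← add_zero (eqPos a q)]
  refine add_eq_add_of_ae_const hd (continuous_logField (q := q) ha) (G := G) (by simp)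
    (eqPos_sub_eqNeg_univ ha) ?_ (ae_of_all _ hG')
  simpa [pot] using hG

theorem IsMinimizer.support_eq_univ_iff (hd : 1 ≤ d) (ha : ‖a‖ ≠ 1) (hq : q ≠ 0)
    {μ : ProbabilityMeasure (UnitSphere d)}
    (hμ : IsMinimizer (fun x : UnitSphere d => logField a q x.1) μ) :
    (μ : Measure (UnitSphere d)).support = Set.univ ↔
      ∀ x : UnitSphere d, 0 ≤ eqDensity a q x := by
  constructor
  · intro hs
    have hadd := hμ.add_eqNeg_eq hd ha hs
    by_contra! hneg
    obtain ⟨x, hx⟩ := hneg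
    -- On this nonempty open set `eqPos` vanishes, and `μ ≤ eqPos`, so `μ` would not charge it.
    have hU : IsOpen {y : UnitSphere d | eqDensity a q y < 0} :=
      isOpen_lt (continuous_eqDensity ha) continuous_const
    have hpos := (Measure.mem_support_iff_forall x).1 (hs ▸ Set.mem_univ x) _ (hU.mem_nhds hx)
    refine hpos.ne' (le_antisymm ?_ zero_le)
    have h0 : eqPos a q {y : UnitSphere d | eqDensity a q y < 0} = 0 := by
      rw [eqPos, withDensity_apply _ hU.measurableSet]
      exact setLIntegral_eq_zero hU.measurableSet fun y hy =>
        ENNReal.ofReal_of_nonpos (le_of_lt hy)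
    rw [← h0, ← hadd, Measure.add_apply]
    exact le_self_add
  · intro h
    have hneg : eqNeg a q = 0 := by
      rw [eqNeg, withDensity_eq_zero_iff]
      · exact ae_of_all _ fun y => ENNReal.ofReal_of_nonpos (neg_nonpos.2 (h y))
      · exact (continuous_eqDensity ha).neg.measurable.ennreal_ofReal.aemeasurable
    have hfin : IsFiniteMeasure (eqPos a q) :=
      isFiniteMeasure_withDensity_unif (continuous_eqDensity ha)
    have hprob : IsProbabilityMeasure (eqPos a q) := by
      have := eqPos_sub_eqNeg_univ (q := q) ha
      rw [hneg, measureReal_zero_apply, sub_zero] at this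
      exact isProbabilityMeasure_iff_real.2 this
    obtain ⟨G, hG⟩ := exists_pot_eqPos_sub (q := q) hd ha
    rw [hneg] at hG
    have hE : mutEnergy (eqPos a q) (eqPos a q) ≠ ⊤ := by
      obtain ⟨K, hK, hle⟩ := withDensity_le_smul_unif (continuous_eqDensity (q := q) ha)
      refine ((mutEnergy_mono hle hle).trans_lt ?_).ne
      rw [mutEnergy_smul_left, mutEnergy_comm, mutEnergy_smul_left]
      have := mutEnergy_unif_ne_top hd
      exact ENNReal.mul_lt_top hK.lt_top (ENNReal.mul_lt_top hK.lt_top this.lt_top)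
    have hmin : IsMinimizer (fun x : UnitSphere d => logField a q x.1) ⟨eqPos a q, hprob⟩ :=
      isMinimizer_of_const (G := G) (continuous_logField ha) hE fun x => by
        simpa [pot] using hG x
    rw [hμ.unique (continuous_logField ha) hmin]
    exact support_eqPos hd ha hq h

end UnitSphere

end LogEquilibrium

/-! ### The theorem -/

open UnitSphere in
theorem mainTheorem10 (d : ℕ) (hd : 1 ≤ d) (a : EuclideanSpace ℝ (Fin (d + 1)))
    (R : ℝ) (hR : R = ‖a‖) (hR1 : R ≠ 1) (q : ℝ) (hq : q ≠ 0)
    (α : ℝ) (hα : α = ((1 + q) / q) ^ (1 / (d : ℝ))) :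
    ∃ (μ : MeasureTheory.ProbabilityMeasure (UnitSphere d))
      (η : MeasureTheory.SignedMeasure (UnitSphere d)),
      -- `μ` is the extremal measure and `η` is the signed equilibrium
      (IsLogExtremal a q μ ∧ ∀ ν, IsLogExtremal a q ν → ν = μ) ∧
      (IsSignedLogEquilibrium a q η ∧ ∀ θ, IsSignedLogEquilibrium a q θ → θ = η) ∧
      -- full support implies that the two coincide
      ((μ : MeasureTheory.Measure (UnitSphere d)).support = Set.univ →
        (μ : MeasureTheory.Measure (UnitSphere d)).toSignedMeasure = η) ∧
      -- positive fields
      (0 < q →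
        ((μ : MeasureTheory.Measure (UnitSphere d)).support = Set.univ ↔
          (1 + q) / q ≥ (R + 1) ^ d / |R - 1| ^ d) ∧
        (1 < R → ((μ : MeasureTheory.Measure (UnitSphere d)).support = Set.univ ↔
          R ≥ (α + 1) / (α - 1))) ∧
        (R < 1 → ((μ : MeasureTheory.Measure (UnitSphere d)).support = Set.univ ↔
          R ≤ (α - 1) / (α + 1)))) ∧
      -- negative fields
      (q < 0 →
        ((μ : MeasureTheory.Measure (UnitSphere d)).support = Set.univ ↔
          (1 + q) / q ≤ |R - 1| ^ d / (R + 1) ^ d)) ∧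
      (q < -1 →
        (1 < R → ((μ : MeasureTheory.Measure (UnitSphere d)).support = Set.univ ↔
          R ≥ (1 + α) / (1 - α))) ∧
        (R < 1 → ((μ : MeasureTheory.Measure (UnitSphere d)).support = Set.univ ↔
          R ≤ (1 - α) / (1 + α)))) ∧
      (-1 ≤ q → q < 0 →
        (1 + q) / q ≤ |R - 1| ^ d / (R + 1) ^ d ∧
        (μ : MeasureTheory.Measure (UnitSphere d)).support = Set.univ) := by
  have ha : ‖a‖ ≠ 1 := hR ▸ hR1
  have hR0 : 0 ≤ R := hR ▸ norm_nonneg a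
  have hd0 : d ≠ 0 := by omega
  obtain ⟨μ, hμ⟩ := exists_isMinimizer hd (continuous_logField (q := q) ha)
  have hfin₁ : IsFiniteMeasure (eqPos a q) :=
    isFiniteMeasure_withDensity_unif (continuous_eqDensity ha)
  have hfin₂ : IsFiniteMeasure (eqNeg a q) :=
    isFiniteMeasure_withDensity_unif (continuous_eqDensity ha).neg
  obtain ⟨G, hG⟩ := exists_pot_eqPos_sub (q := q) hd ha
  have hη : IsSignedLogEquilibrium a q
      ((eqPos a q).toSignedMeasure - (eqNeg a q).toSignedMeasure) :=
    isSignedLogEquilibrium_sub (eqPos_sub_eqNeg_univ ha)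
      (pot_withDensity_ne_top hd (continuous_eqDensity ha))
      (pot_withDensity_ne_top hd (continuous_eqDensity ha).neg) hG
  have hsupp := hμ.support_eq_univ_iff hd ha hq
  have habs : 0 < |R - 1| := abs_pos.2 (sub_ne_zero.2 hR1)
  have hαnn : 0 ≤ (1 + q) / q → 0 ≤ α := fun h => hα ▸ Real.rpow_nonneg h _
  have hαpow : 0 ≤ (1 + q) / q → α ^ d = (1 + q) / q := fun h => by
    rw [hα, one_div, Real.rpow_inv_natCast_pow h hd0]
  -- Taking `d`-th roots makes the criterion a linear inequality in `R`; `α > 1` for `q > 0`, and `0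
  -- ≤ α < 1` for `q < -1`, give the signs of the denominators.
  have hpos : 0 < q → ((μ : Measure (UnitSphere d)).support = Set.univ ↔
      (R + 1) / |R - 1| ≤ α) := fun hq0 => by
    have h0 : 0 ≤ (1 + q) / q := by positivity
    rw [hsupp, forall_eqDensity_nonneg_iff_of_pos ha hq0, ← hR, ← hαpow h0,
      pow_le_pow_iff_left₀ (by positivity) (hαnn h0) hd0]
  have hneg : q < -1 → ((μ : Measure (UnitSphere d)).support = Set.univ ↔
      α ≤ |R - 1| / (R + 1)) := fun hq0 => by
    have h0 : 0 ≤ (1 + q) / q := div_nonneg_of_nonpos (by linarith) (by linarith)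
    rw [hsupp, forall_eqDensity_nonneg_iff_of_neg ha (by linarith), ← hR, ← hαpow h0,
      pow_le_pow_iff_left₀ (hαnn h0) (by positivity) hd0]
  have hαgt : 0 < q → 1 < α := fun hq0 => by
    have h0 : 0 ≤ (1 + q) / q := by positivity
    by_contra! h
    have h1 := pow_le_one₀ (n := d) (hαnn h0) h
    rw [hαpow h0, div_le_one hq0] at h1
    linarith
  have hαlt : q < -1 → 0 ≤ α ∧ α < 1 := fun hq0 => by
    have h0 : 0 ≤ (1 + q) / q := div_nonneg_of_nonpos (by linarith) (by linarith)
    refine ⟨hαnn h0, ?_⟩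
    by_contra! h
    have h1 := one_le_pow₀ (n := d) h
    rw [hαpow h0, le_div_iff_of_neg (by linarith)] at h1
    linarith
  refine ⟨μ, (eqPos a q).toSignedMeasure - (eqNeg a q).toSignedMeasure,
    ⟨(isLogExtremal_iff_isMinimizer hd μ).2 hμ, fun ν hν =>
      ((isLogExtremal_iff_isMinimizer hd ν).1 hν).unique (continuous_logField ha) hμ⟩,
    ⟨hη, fun θ hθ => isSignedLogEquilibrium_unique hd ha hθ hη⟩, fun hs => ?_, fun hq0 => ?_,
    fun hq0 => ?_, fun hq0 => ?_, fun hq1 hq0 => ?_⟩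
  · have hadd := hμ.add_eqNeg_eq hd ha hs
    ext A hA
    rw [Measure.toSignedMeasure_sub_apply hA, ← hadd, measureReal_add_apply, add_sub_cancel_right,
      Measure.toSignedMeasure_apply_measurable hA]
  · refine ⟨?_, fun h1 => ?_, fun h1 => ?_⟩
    · rw [hsupp, forall_eqDensity_nonneg_iff_of_pos ha hq0, ← hR, div_pow]
    · have := hαgt hq0
      rw [hpos hq0, abs_of_pos (by linarith), div_le_iff₀ (by linarith), ge_iff_le,
        div_le_iff₀ (by linarith)]
      constructor <;> intro h <;> linarith
    · have := hαgt hq0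
      rw [hpos hq0, abs_of_neg (by linarith), div_le_iff₀ (by linarith),
        le_div_iff₀ (by linarith)]
      constructor <;> intro h <;> linarith
  · rw [hsupp, forall_eqDensity_nonneg_iff_of_neg ha hq0, ← hR, div_pow]
  · obtain ⟨h2, h3⟩ := hαlt hq0
    refine ⟨fun h1 => ?_, fun h1 => ?_⟩
    · rw [hneg hq0, abs_of_pos (by linarith), le_div_iff₀ (by linarith), ge_iff_le,
        div_le_iff₀ (by linarith)]
      constructor <;> intro h <;> linarith
    · rw [hneg hq0, abs_of_neg (by linarith), le_div_iff₀ (by linarith),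
        le_div_iff₀ (by linarith)]
      constructor <;> intro h <;> linarith
  -- Here `(1 + q) / q ≤ 0`, so the criterion holds trivially and `α` plays no role.
  · have h1 : (1 + q) / q ≤ |R - 1| ^ d / (R + 1) ^ d :=
      (div_nonpos_of_nonneg_of_nonpos (by linarith) hq0.le).trans (by positivity)
    refine ⟨h1, ?_⟩
    rwa [hsupp, forall_eqDensity_nonneg_iff_of_neg ha hq0, ← hR, div_pow]
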